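/- Let $c>0$, $\lambda>0$, $p,q\ge 0$ with $p+q\le 1$, and let $d_j=(\cos\frac{\pi j}{2},\sin\frac{\pi j}{2})$ for $j\in\mathbb{Z}$, so that $d_{j+4}=d_j$. A particle with position $(X(t),Y(t))$ starts at the origin at time $0$ and moves with constant speed $c$; its initial direction is chosen uniformly among $d_0,d_1,d_2,d_3$. At the arrival times of a Poisson process of intensity $\lambda$ the direction changes, from $d_j$ to $d_{j+1}$ with probability $p$, to $d_{j-1}$ with probability $q$, and to $d_{j+2}$ with probability $1-p-q$; the initial direction, the Poisson process and the successive choices of turn are mutually independent. Let $I_0(x)=\sum_{k\ge 0}\frac{(x/2)^{2k}}{(k!)^2}$ be the modified Bessel function of order zero. For every $t>0$, the density on the open side $\{x+y=ct,\ |x-y|<ct\}$ of the square $\{|x+y|\le ct,\ |x-y|\le ct\}$, $$f(\eta,t)=\mathbb{P}\big(X(t)+Y(t)=ct,\ X(t)-Y(t)\in d\eta\big)/d\eta,\qquad |\eta|<ct,$$ exists and is $$f(\eta,t)=\frac{e^{-\lambda t}}{4c}\left[\frac{\lambda(p+q)}{2}\,I_0\!\left(\frac{\lambda}{c}\sqrt{pq}\,\sqrt{c^2t^2-\eta^2}\right)+\frac{\partial}{\partial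 t}I_0\!\left(\frac{\lambda}{c}\sqrt{pq}\,\sqrt{c^2t^2-\eta^2}\right)\right].$$ That is, this function is well defined and nonnegative for $|\eta|<ct$, and for every Borel set $B\subseteq(-ct,ct)$, $$\mathbb{P}\big(X(t)+Y(t)=ct,\ X(t)-Y(t)\in B\big)=\int_B f(\eta,t)\,d\eta .$$ -/

import Mathlib

open MeasureTheory ProbabilityTheory

noncomputable section

namespace PlanarMotion

/-- The modified Bessel function of the first kind of order zero,
`I₀(x) = ∑ₖ (x/2)^(2k) / (k!)²`. -/
def besselI0 (x : ℝ) : ℝ :=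
  ∑' k : ℕ, (x / 2) ^ (2 * k) / ((k.factorial : ℝ) ^ 2)

/-- The law of one change of direction, as an increment of the index `j` of the direction
`d_j = (cos (π j / 2), sin (π j / 2))`: a counter-clockwise turn `+1` with probability `p`,
a clockwise turn `-1` with probability `q`, a reversal `+2` with probability `1 - p - q`. -/
def turnLaw (p q : ℝ) : Measure ℤ :=
  ENNReal.ofReal p • Measure.dirac 1 + ENNReal.ofReal q • Measure.dirac (-1)
    + ENNReal.ofReal (1 - p - q) • Measure.dirac 2

variable {Ω : Type*}

/-- The time of the `n`-th event when `W i` is the waiting time between the `i`-th and the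
`(i+1)`-st event. -/
def arrivalTime (W : ℕ → Ω → ℝ) (n : ℕ) (ω : Ω) : ℝ :=
  ∑ i ∈ Finset.range n, W i ω

/-- The number `N(t)` of events up to time `t`. For independent exponential waiting times of
rate `lam` this is the Poisson process of intensity `lam`. -/
def eventCount (W : ℕ → Ω → ℝ) (t : ℝ) (ω : Ω) : ℕ :=
  Set.ncard {n : ℕ | 1 ≤ n ∧ arrivalTime W n ω ≤ t}

/-- The index `j` of the direction `D(t) = d_j` at time `t`; the index is an integer, with
`d_j = d_(j+4)`. It starts at `J₀` and the event number `i + 1` adds `E i` to it. -/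
def dirIndex (J₀ : Ω → ℤ) (W : ℕ → Ω → ℝ) (E : ℕ → Ω → ℤ) (t : ℝ) (ω : Ω) : ℤ :=
  J₀ ω + ∑ i ∈ Finset.range (eventCount W t ω), E i ω

/-- The abscissa `X(t)` of the particle, which starts at the origin and moves with speed `c`
in the current direction. -/
def posX (c : ℝ) (J₀ : Ω → ℤ) (W : ℕ → Ω → ℝ) (E : ℕ → Ω → ℤ) (t : ℝ) (ω : Ω) : ℝ :=
  ∫ s in (0 : ℝ)..t, c * Real.cos (Real.pi / 2 * (dirIndex J₀ W E s ω : ℝ))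

/-- The ordinate `Y(t)` of the particle. -/
def posY (c : ℝ) (J₀ : Ω → ℤ) (W : ℕ → Ω → ℝ) (E : ℕ → Ω → ℤ) (t : ℝ) (ω : Ω) : ℝ :=
  ∫ s in (0 : ℝ)..t, c * Real.sin (Real.pi / 2 * (dirIndex J₀ W E s ω : ℝ))

/-- The randomness that drives the motion: a uniform initial direction among `d_0, …, d_3`,
exponential waiting times of rate `lam` (so that the changes of direction are the arrivals of a
Poisson process of intensity `lam`), and turns with law `turnLaw p q`, all mutually
independent. -/
structure IsDriving [MeasurableSpace Ω] (P : Measure Ω) (lam p q : ℝ)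
    (J₀ : Ω → ℤ) (W : ℕ → Ω → ℝ) (E : ℕ → Ω → ℤ) : Prop where
  initial_law : HasLaw J₀ (uniformOn ({0, 1, 2, 3} : Set ℤ)) P
  waiting_law : ∀ n, HasLaw (W n) (expMeasure lam) P
  turn_law : ∀ n, HasLaw (E n) (turnLaw p q) P
  waiting_indep : iIndepFun W P
  turn_indep : iIndepFun E P
  waiting_turn_indep : IndepFun (fun ω n => W n ω) (fun ω n => E n ω) P
  initial_indep : IndepFun J₀ (fun ω => ((fun n => W n ω), (fun n => E n ω))) P

/-- The function `(η, t) ↦ I₀((lam/c) √(pq) √(c²t² - η²))`. -/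
def besselProfile (c lam p q η t : ℝ) : ℝ :=
  besselI0 (lam / c * Real.sqrt (p * q) * Real.sqrt (c ^ 2 * t ^ 2 - η ^ 2))

/-- The claimed density `f(η, t)` on an open side of the square. -/
def sideDensity (c lam p q η t : ℝ) : ℝ :=
  Real.exp (-lam * t) / (4 * c) *
    (lam * (p + q) / 2 * besselProfile c lam p q η t
      + deriv (fun s => besselProfile c lam p q η s) t)

end PlanarMotion

end

open MeasureTheory ProbabilityTheory

noncomputable section

namespace PlanarMotion

open scoped ENNReal

variable {Ω : Type*}

/-! Each direction `d_j` moves `x + y` at rate at most `c`, with equality exactly for `d_0` and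
`d_1`. So `X + Y = ct` forces the path to use these two directions only: it starts at `a ∈ {0, 1}`
and its turns are alternately `+1` (probability `p`, from `d_0`) and `-1` (probability `q`, from
`d_1`). This is `posX_add_posY_eq_iff` with `directions_iff_alternating`.

Given `n` turns before `t`, let `x` be the time spent in the direction opposite to the last one.
Then `X - Y = ±c(t - 2x)`, the sign depending on the parity of `n + a` (`posX_sub_posY_eq`). Here
`x` is a sum of `⌈n/2⌉` complete waiting times, while the last direction takes the other `⌊n/2⌋` and
an unfinished one. An Erlang density for `x` times a Poisson probability for the remaining time `t -
x` gives the density `λⁿ e^{-λt} x^{⌈n/2⌉-1} (t-x)^{⌊n/2⌋} / ((⌈n/2⌉-1)! ⌊n/2⌋!)`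
(`measure_sum_waiting`), which is multiplied by the initial probability `1/4` and the probability of
the turns (`measure_alternatingEvent`). Passing from `x` to `η` costs a Jacobian `1/(2c)`
(`lintegral_oppositeTime`). No turn at all leads to a corner, so `n ≥ 1`.

Summing over `n` and `a` gives the Bessel function (`hasSum_sideDensity`), because `x(t - x) = (c²t²
- η²)/(4c²)`. Odd `n` has equal powers of `x` and `t - x`, and the two starts give `(p + q)(pq)^m`:
this is the `I₀` term. Even `n` has one factor `t - x` in excess; the two starts exchange `x` and `t
- x`, so these factors add up to `t`: this is the time derivative. -/

/-! ### Erlang laws and Poisson probabilities. -/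

/-- The density of the sum of `n + 1` independent exponential variables of rate `lam`. -/
def erlangPDF (lam : ℝ) (n : ℕ) : ℝ → ℝ≥0∞ :=
  (Set.Ici 0).indicator fun x =>
    ENNReal.ofReal (lam ^ (n + 1) * x ^ n / n.factorial * Real.exp (-(lam * x)))

@[fun_prop]
lemma measurable_erlangPDF (lam : ℝ) (n : ℕ) : Measurable (erlangPDF lam n) := by
  unfold erlangPDF
  exact Measurable.indicator (by fun_prop) measurableSet_Ici

lemma expMeasure_eq_withDensity (lam : ℝ) :
    expMeasure lam = volume.withDensity (erlangPDF lam 0) := by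
  unfold expMeasure gammaMeasure
  congr 1
  ext x
  change exponentialPDF lam x = _
  rw [exponentialPDF_eq, erlangPDF, Set.indicator_apply]
  by_cases h : 0 ≤ x <;> simp [h]

lemma lintegral_Icc_const_mul_pow {K x : ℝ} (hK : 0 ≤ K) (hx : 0 ≤ x) (n : ℕ) :
    ∫⁻ y in Set.Icc 0 x, ENNReal.ofReal (K * y ^ n) =
      ENNReal.ofReal (K * x ^ (n + 1) / (n + 1)) := by
  rw [← ofReal_integral_eq_lintegral_ofReal]
  · rw [integral_Icc_eq_integral_Ioc, ← intervalIntegral.integral_of_le hx,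
      intervalIntegral.integral_const_mul, integral_pow]
    congr 1
    simp
    ring
  · exact ContinuousOn.integrableOn_Icc (by fun_prop)
  · filter_upwards [ae_restrict_mem measurableSet_Icc] with y hy
    have := hy.1
    positivity

/-- The exponential factors multiply to one that does not depend on the integration variable, so
only the integral of `y ^ n` over `[0, x]` remains. -/
lemma erlangPDF_lconvolution_exp {lam : ℝ} (hlam : 0 < lam) (n : ℕ) :
    lconvolution (erlangPDF lam n) (erlangPDF lam 0) volume = erlangPDF lam (n + 1) := by
  ext x
  rw [lconvolution_def]
  have key : ∀ y, erlangPDF lam n y * erlangPDF lam 0 (-y + x) =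
      (Set.Icc 0 x).indicator (fun y =>
        ENNReal.ofReal (lam ^ (n + 2) / n.factorial * Real.exp (-(lam * x)) * y ^ n)) y := by
    intro y
    simp only [erlangPDF, Set.indicator_apply, Set.mem_Ici, Set.mem_Icc]
    by_cases h0 : 0 ≤ y
    · by_cases h1 : y ≤ x
      · rw [if_pos h0, if_pos (by linarith), if_pos ⟨h0, h1⟩, ← ENNReal.ofReal_mul (by positivity)]
        congr 1
        rw [show -(lam * x) = -(lam * y) + -(lam * (-y + x)) by ring, Real.exp_add]
        simp
        ring
      · rw [if_pos h0, if_neg (by linarith), if_neg (by tauto), mul_zero]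
    · rw [if_neg h0, zero_mul, if_neg (by tauto)]
  simp_rw [key]
  rw [lintegral_indicator measurableSet_Icc]
  by_cases hx : 0 ≤ x
  · rw [lintegral_Icc_const_mul_pow (by positivity) hx, erlangPDF,
      Set.indicator_of_mem (show x ∈ Set.Ici 0 from hx)]
    congr 1
    rw [Nat.factorial_succ]
    push_cast
    field_simp
  · rw [Set.Icc_eq_empty hx, erlangPDF, Set.indicator_of_notMem (show x ∉ Set.Ici 0 from hx)]
    simp

/-- The law of the sum of `n` independent exponential variables of rate `lam`. -/
def erlangMeasure (lam : ℝ) : ℕ → Measure ℝ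
  | 0 => Measure.dirac 0
  | n + 1 => volume.withDensity (erlangPDF lam n)

lemma erlangMeasure_conv_exp {lam : ℝ} (hlam : 0 < lam) (n : ℕ) :
    (erlangMeasure lam n).conv (expMeasure lam) = erlangMeasure lam (n + 1) := by
  have := isProbabilityMeasure_expMeasure hlam
  cases n with
  | zero => rw [erlangMeasure, Measure.dirac_zero_conv, expMeasure_eq_withDensity, erlangMeasure]
  | succ n =>
    rw [expMeasure_eq_withDensity, erlangMeasure, erlangMeasure,
      conv_withDensity_eq_lconvolution (by fun_prop) (by fun_prop),
      erlangPDF_lconvolution_exp hlam]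

lemma expMeasure_Ioi {lam : ℝ} (hlam : 0 < lam) {x : ℝ} (hx : 0 ≤ x) :
    expMeasure lam (Set.Ioi x) = ENNReal.ofReal (Real.exp (-(lam * x))) := by
  have := isProbabilityMeasure_expMeasure hlam
  rw [← Set.compl_Iic, prob_compl_eq_one_sub measurableSet_Iic, expMeasure, gammaMeasure,
    withDensity_apply _ measurableSet_Iic]
  change 1 - ∫⁻ y in Set.Iic x, exponentialPDF lam y = _
  rw [lintegral_exponentialPDF_eq_antiDeriv hlam, if_pos hx, ← ENNReal.ofReal_one,
    ← ENNReal.ofReal_sub]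
  · simp
  · have : Real.exp (-(lam * x)) ≤ 1 := Real.exp_le_one_iff.2 (by nlinarith)
    linarith

instance (lam : ℝ) (n : ℕ) : SFinite (erlangMeasure lam n) := by
  cases n <;> (unfold erlangMeasure; infer_instance)

/-- The probability that a Poisson process of rate `lam` has `n` arrivals up to time `s`. -/
def poissonWeight (lam : ℝ) (n : ℕ) (s : ℝ) : ℝ :=
  lam ^ n * s ^ n / n.factorial * Real.exp (-(lam * s))

/-- A sum of `n` waiting times followed by one more gives the Poisson probabilities. -/
lemma erlangMeasure_prod_exp_apply {lam : ℝ} (hlam : 0 < lam) (n : ℕ) (s : ℝ) :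
    ((erlangMeasure lam n).prod (expMeasure lam)) {z | z.1 ≤ s ∧ s < z.1 + z.2} =
      (Set.Ici 0).indicator (fun s => ENNReal.ofReal (poissonWeight lam n s)) s := by
  have := isProbabilityMeasure_expMeasure hlam
  have hm : MeasurableSet {z : ℝ × ℝ | z.1 ≤ s ∧ s < z.1 + z.2} :=
    (measurableSet_le measurable_fst measurable_const).inter
      (measurableSet_lt measurable_const (measurable_fst.add measurable_snd))
  rw [Measure.prod_apply hm]
  -- With the sum fixed at `x`, the next waiting time has to exceed `s - x`: an exponential tail.
  have hsec : ∀ x : ℝ, expMeasure lam (Prod.mk x ⁻¹' {z : ℝ × ℝ | z.1 ≤ s ∧ s < z.1 + z.2}) =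
      (Set.Iic s).indicator (fun x => ENNReal.ofReal (Real.exp (-(lam * (s - x))))) x := by
    intro x
    by_cases hx : x ≤ s
    · rw [Set.indicator_of_mem (show x ∈ Set.Iic s from hx), ← expMeasure_Ioi hlam (by linarith)]
      congr 1
      ext w
      simp [hx, sub_lt_iff_lt_add']
    · rw [Set.indicator_of_notMem (show x ∉ Set.Iic s from hx)]
      convert measure_empty (μ := expMeasure lam)
      ext w
      simp [hx]
  simp_rw [hsec]
  cases n with
  | zero =>
    rw [erlangMeasure, lintegral_dirac]
    simp [Set.indicator_apply, poissonWeight]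
  | succ n =>
    rw [erlangMeasure, lintegral_withDensity_eq_lintegral_mul _ (by fun_prop)
      (Measurable.indicator (by fun_prop) measurableSet_Iic)]
    have key : ∀ y, (erlangPDF lam n * (Set.Iic s).indicator
        (fun x => ENNReal.ofReal (Real.exp (-(lam * (s - x)))))) y =
      (Set.Icc 0 s).indicator (fun y =>
        ENNReal.ofReal (lam ^ (n + 1) / n.factorial * Real.exp (-(lam * s)) * y ^ n)) y := by
      intro y
      simp only [erlangPDF, Set.indicator_apply, Set.mem_Ici, Set.mem_Icc, Set.mem_Iic,
        Pi.mul_apply]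
      by_cases h0 : 0 ≤ y
      · by_cases h1 : y ≤ s
        · rw [if_pos h0, if_pos h1, if_pos ⟨h0, h1⟩, ← ENNReal.ofReal_mul (by positivity)]
          congr 1
          rw [show -(lam * s) = -(lam * y) + -(lam * (s - y)) by ring, Real.exp_add]
          ring
        · rw [if_pos h0, if_neg h1, if_neg (by tauto), mul_zero]
      · rw [if_neg h0, zero_mul, if_neg (by tauto)]
    simp_rw [key]
    rw [lintegral_indicator measurableSet_Icc]
    by_cases hs : 0 ≤ s
    · rw [lintegral_Icc_const_mul_pow (by positivity) hs,
        Set.indicator_of_mem (show s ∈ Set.Ici 0 from hs), poissonWeight]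
      congr 1
      rw [Nat.factorial_succ]
      push_cast
      field_simp
    · rw [Set.Icc_eq_empty hs, Set.indicator_of_notMem (show s ∉ Set.Ici 0 from hs)]
      simp

/-- The joint law of one sum of waiting times and of the Poisson event for another one. -/
lemma prod_erlangMeasure_prod_exp_apply {lam : ℝ} (hlam : 0 < lam) (k l : ℕ) (t : ℝ)
    {C : Set ℝ} (hC : MeasurableSet C) (hCt : C ⊆ Set.Ioo 0 t) :
    ((erlangMeasure lam (k + 1)).prod ((erlangMeasure lam l).prod (expMeasure lam)))
        {z | z.1 ∈ C ∧ z.2.1 ≤ t - z.1 ∧ t - z.1 < z.2.1 + z.2.2} =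
      ∫⁻ x in C, ENNReal.ofReal (lam ^ (k + l + 1) * Real.exp (-(lam * t)) * x ^ k * (t - x) ^ l
        / (k.factorial * l.factorial)) := by
  have := isProbabilityMeasure_expMeasure hlam
  have hm : MeasurableSet {z : ℝ × ℝ × ℝ | z.1 ∈ C ∧ z.2.1 ≤ t - z.1 ∧ t - z.1 < z.2.1 + z.2.2} :=
    (hC.preimage measurable_fst).inter
      ((measurableSet_le (f := fun z : ℝ × ℝ × ℝ => z.2.1) (g := fun z => t - z.1)
        (by fun_prop) (by fun_prop)).inter
      (measurableSet_lt (f := fun z : ℝ × ℝ × ℝ => t - z.1) (g := fun z => z.2.1 + z.2.2)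
        (by fun_prop) (by fun_prop)))
  rw [Measure.prod_apply hm]
  have hsec : ∀ x : ℝ, ((erlangMeasure lam l).prod (expMeasure lam))
      (Prod.mk x ⁻¹' {z : ℝ × ℝ × ℝ | z.1 ∈ C ∧ z.2.1 ≤ t - z.1 ∧ t - z.1 < z.2.1 + z.2.2}) =
      C.indicator (fun x => ENNReal.ofReal (poissonWeight lam l (t - x))) x := by
    intro x
    by_cases hx : x ∈ C
    · have := erlangMeasure_prod_exp_apply hlam l (t - x)
      rw [Set.indicator_of_mem (show t - x ∈ Set.Ici 0 by have := (hCt hx).2; simp; linarith)]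
        at this
      rw [Set.indicator_of_mem hx, ← this]
      congr 1
      ext w
      simp [hx]
    · rw [Set.indicator_of_notMem hx]
      convert measure_empty (μ := (erlangMeasure lam l).prod (expMeasure lam))
      ext w
      simp [hx]
  simp_rw [hsec]
  rw [erlangMeasure, lintegral_withDensity_eq_lintegral_mul _ (by fun_prop)
    (Measurable.indicator (by unfold poissonWeight; fun_prop) hC), ← lintegral_indicator hC]
  congr 1
  ext x
  simp only [Pi.mul_apply]
  by_cases hx : x ∈ C
  · have h0 := (hCt hx).1.le
    rw [Set.indicator_of_mem hx, Set.indicator_of_mem hx, erlangPDF,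
      Set.indicator_of_mem (show x ∈ Set.Ici 0 from h0), ← ENNReal.ofReal_mul (by positivity)]
    congr 1
    rw [poissonWeight, show -(lam * t) = -(lam * x) + -(lam * (t - x)) by ring, Real.exp_add]
    field_simp
    ring
  · simp [hx]

/-! ### Joint laws and almost sure properties of the waiting times. -/

section Waiting

variable [MeasurableSpace Ω] {P : Measure Ω} {lam : ℝ} {W : ℕ → Ω → ℝ}

lemma map_sum_waiting [IsProbabilityMeasure P] (hlam : 0 < lam) (hWm : ∀ i, Measurable (W i))
    (hW : ∀ i, P.map (W i) = expMeasure lam) (hind : iIndepFun W P) (s : Finset ℕ) :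
    P.map (fun ω => ∑ i ∈ s, W i ω) = erlangMeasure lam s.card := by
  have := isProbabilityMeasure_expMeasure hlam
  induction s using Finset.induction_on with
  | empty => simp [erlangMeasure]
  | insert i s hi ih =>
    have hsum : Measurable (fun ω => ∑ i ∈ s, W i ω) :=
      Finset.measurable_fun_sum _ fun i _ => hWm i
    have h : IndepFun (fun ω => ∑ i ∈ s, W i ω) (W i) P := by
      simpa only [← Finset.sum_fn] using hind.indepFun_finsetSum_of_notMem hWm hi
    have h' := h.map_add_eq_map_conv_map hsum (hWm i)
    rw [ih, hW, erlangMeasure_conv_exp hlam] at h'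
    rw [Finset.card_insert_of_notMem hi, ← h']
    congr 1
    ext ω
    simp [Finset.sum_insert hi, add_comm]

/-- The joint law of two sums of disjoint families of waiting times and one more waiting time. -/
lemma map_sum_waiting_prod [IsProbabilityMeasure P] (hlam : 0 < lam)
    (hWm : ∀ i, Measurable (W i)) (hW : ∀ i, P.map (W i) = expMeasure lam)
    (hind : iIndepFun W P) {s s' : Finset ℕ} (hss : Disjoint s s') {n : ℕ} (hn : n ∉ s)
    (hn' : n ∉ s') :
    P.map (fun ω => (∑ i ∈ s, W i ω, ∑ i ∈ s', W i ω, W n ω)) =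
      (erlangMeasure lam s.card).prod ((erlangMeasure lam s'.card).prod (expMeasure lam)) := by
  have hms : ∀ s : Finset ℕ, Measurable (fun ω => ∑ i ∈ s, W i ω) := fun s =>
    Finset.measurable_fun_sum _ fun i _ => hWm i
  have h2 : IndepFun (fun ω => ∑ i ∈ s', W i ω) (W n) P := by
    simpa only [← Finset.sum_fn] using hind.indepFun_finsetSum_of_notMem hWm hn'
  have h1 : IndepFun (fun ω => ∑ i ∈ s, W i ω) (fun ω => (∑ i ∈ s', W i ω, W n ω)) P := by
    -- Adding `n` to the second block makes the pair a function of a single block disjoint from `s`,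
    -- so independence of two blocks suffices.
    have hd : Disjoint s (insert n s') := by
      rw [Finset.disjoint_insert_right]; exact ⟨hn, hss⟩
    have hφ : Measurable fun x : s → ℝ => ∑ i, x i := by fun_prop
    have hψ : Measurable fun x : ↥(insert n s') → ℝ =>
        (∑ i : s', x (⟨i.1, Finset.mem_insert_of_mem i.2⟩ : ↥(insert n s')),
          x (⟨n, Finset.mem_insert_self n s'⟩ : ↥(insert n s'))) := by
      refine Measurable.prodMk ?_ (measurable_pi_apply _)
      exact Finset.measurable_fun_sum _ fun i _ => measurable_pi_apply _
    have := (hind.indepFun_finset s (insert n s') hd hWm).comp hφ hψ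
    convert! this using 1
    · ext ω
      simp only [Function.comp]
      exact (Finset.sum_coe_sort s (fun i => W i ω)).symm
    · ext ω
      · simp only [Function.comp]
        exact (Finset.sum_coe_sort s' (fun i => W i ω)).symm
      · rfl
  rw [(indepFun_iff_map_prod_eq_prod_map_map (hms s).aemeasurable
      ((hms s').prodMk (hWm n)).aemeasurable).1 h1,
    (indepFun_iff_map_prod_eq_prod_map_map (hms s').aemeasurable (hWm n).aemeasurable).1 h2,
    map_sum_waiting hlam hWm hW hind, map_sum_waiting hlam hWm hW hind, hW]

lemma measure_sum_waiting [IsProbabilityMeasure P] (hlam : 0 < lam)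
    (hWm : ∀ i, Measurable (W i)) (hW : ∀ i, P.map (W i) = expMeasure lam)
    (hind : iIndepFun W P) {s s' : Finset ℕ} (hss : Disjoint s s') {n k l : ℕ} (hn : n ∉ s)
    (hn' : n ∉ s') (hs : s.card = k + 1) (hs' : s'.card = l) (t : ℝ) {C : Set ℝ}
    (hC : MeasurableSet C) (hCt : C ⊆ Set.Ioo 0 t) :
    P {ω | ∑ i ∈ s, W i ω ∈ C ∧ ∑ i ∈ s', W i ω ≤ t - ∑ i ∈ s, W i ω ∧
        t - ∑ i ∈ s, W i ω < ∑ i ∈ s', W i ω + W n ω} =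
      ∫⁻ x in C, ENNReal.ofReal (lam ^ (k + l + 1) * Real.exp (-(lam * t)) * x ^ k * (t - x) ^ l
        / (k.factorial * l.factorial)) := by
  have hms : ∀ s : Finset ℕ, Measurable (fun ω => ∑ i ∈ s, W i ω) := fun s =>
    Finset.measurable_fun_sum _ fun i _ => hWm i
  rw [← prod_erlangMeasure_prod_exp_apply hlam k l t hC hCt, ← hs, ← hs',
    ← map_sum_waiting_prod hlam hWm hW hind hss hn hn', Measure.map_apply]
  · rfl
  · exact (hms s).prodMk ((hms s').prodMk (hWm n))
  · exact (hC.preimage measurable_fst).inter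
      ((measurableSet_le (f := fun z : ℝ × ℝ × ℝ => z.2.1) (g := fun z => t - z.1)
        (by fun_prop) (by fun_prop)).inter
      (measurableSet_lt (f := fun z : ℝ × ℝ × ℝ => t - z.1) (g := fun z => z.2.1 + z.2.2)
        (by fun_prop) (by fun_prop)))

lemma ae_waiting_pos [IsProbabilityMeasure P] (hlam : 0 < lam) (hWm : ∀ i, Measurable (W i))
    (hW : ∀ i, P.map (W i) = expMeasure lam) : ∀ᵐ ω ∂P, ∀ i, 0 < W i ω := by
  have := isProbabilityMeasure_expMeasure hlam
  refine ae_all_iff.2 fun i => ?_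
  have h : ∀ᵐ x ∂(expMeasure lam), 0 < x := by
    refine (mem_ae_iff_prob_eq_one measurableSet_Ioi).2 ?_
    simpa using expMeasure_Ioi hlam le_rfl
  rw [← hW i] at h
  exact ae_of_ae_map (hWm i).aemeasurable h

lemma ae_arrivalTime_ne [IsProbabilityMeasure P] (hlam : 0 < lam) (hWm : ∀ i, Measurable (W i))
    (hW : ∀ i, P.map (W i) = expMeasure lam) (hind : iIndepFun W P) {t : ℝ} (ht : 0 < t) :
    ∀ᵐ ω ∂P, ∀ n, arrivalTime W n ω ≠ t := by
  refine ae_all_iff.2 fun n => ?_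
  cases n with
  | zero => simp [arrivalTime, ht.ne]
  | succ n =>
    have h : ∀ᵐ x ∂(erlangMeasure lam (Finset.range (n + 1)).card), x ≠ t := by
      rw [Finset.card_range, erlangMeasure]
      exact (withDensity_absolutelyContinuous _ _).ae_le (Measure.ae_ne volume t)
    rw [← map_sum_waiting hlam hWm hW hind] at h
    filter_upwards [ae_of_ae_map (Finset.measurable_fun_sum _ fun i _ => hWm i).aemeasurable h]
      with ω hω
    simpa [arrivalTime] using hω

/-- By the second Borel–Cantelli lemma infinitely many waiting times exceed `1`, so their series
diverges. This rules out explosion before `t`. -/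
lemma ae_arrivalTime_tendsto [IsProbabilityMeasure P] (hlam : 0 < lam)
    (hWm : ∀ i, Measurable (W i))
    (hW : ∀ i, P.map (W i) = expMeasure lam) (hind : iIndepFun W P) :
    ∀ᵐ ω ∂P, Filter.Tendsto (fun n => arrivalTime W n ω) Filter.atTop Filter.atTop := by
  have hset : iIndepSet (fun n => W n ⁻¹' Set.Ioi 1) P := by
    rw [iIndepSet_iff_meas_biInter fun n => hWm n measurableSet_Ioi]
    intro s
    exact hind.measure_inter_preimage_eq_mul s (sets := fun _ => Set.Ioi 1)
      fun _ _ => measurableSet_Ioi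
  have h1 := measure_limsup_eq_one (fun n => hWm n measurableSet_Ioi) hset (by
    have : ∀ n, P (W n ⁻¹' Set.Ioi 1) = ENNReal.ofReal (Real.exp (-(lam * 1))) := fun n => by
      rw [← expMeasure_Ioi hlam zero_le_one, ← hW n, Measure.map_apply (hWm n) measurableSet_Ioi]
    simp_rw [this]
    exact ENNReal.tsum_const_eq_top_of_ne_zero (by simp [Real.exp_pos]))
  have h2 : ∀ᵐ ω ∂P, ω ∈ Filter.limsup (fun n => W n ⁻¹' Set.Ioi 1) Filter.atTop := by
    refine (mem_ae_iff_prob_eq_one ?_).2 h1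
    exact MeasurableSet.measurableSet_limsup fun n => hWm n measurableSet_Ioi
  filter_upwards [h2, ae_waiting_pos hlam hWm hW] with ω hω hpos
  rw [Filter.mem_limsup_iff_frequently_mem] at hω
  simp only [arrivalTime]
  refine (not_summable_iff_tendsto_nat_atTop_of_nonneg fun i => (hpos i).le).1 fun hs => ?_
  have h0 := hs.tendsto_atTop_zero.eventually (gt_mem_nhds one_pos)
  obtain ⟨n, hn1, hn2⟩ := (hω.and_eventually h0).exists
  simp only [Set.mem_preimage, Set.mem_Ioi] at hn1
  linarith

end Waiting

/-! ### Counting events and integrating along one path. -/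

section Path

variable {W : ℕ → Ω → ℝ} {ω : Ω}

lemma arrivalTime_zero : arrivalTime W 0 ω = 0 := by simp [arrivalTime]

lemma arrivalTime_succ (n : ℕ) : arrivalTime W (n + 1) ω = arrivalTime W n ω + W n ω := by
  simp [arrivalTime, Finset.sum_range_succ]

lemma strictMono_arrivalTime (hpos : ∀ i, 0 < W i ω) :
    StrictMono fun n => arrivalTime W n ω :=
  strictMono_nat_of_lt_succ fun n => by rw [arrivalTime_succ]; linarith [hpos n]

lemma arrivalTime_nonneg (hpos : ∀ i, 0 < W i ω) (n : ℕ) : 0 ≤ arrivalTime W n ω :=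
  Finset.sum_nonneg fun i _ => (hpos i).le

lemma eventCount_eq (hpos : ∀ i, 0 < W i ω) {n : ℕ} {s : ℝ} (h1 : arrivalTime W n ω ≤ s)
    (h2 : s < arrivalTime W (n + 1) ω) : eventCount W s ω = n := by
  have hmono := strictMono_arrivalTime hpos
  have : {m : ℕ | 1 ≤ m ∧ arrivalTime W m ω ≤ s} = (Finset.Icc 1 n : Set ℕ) := by
    ext m
    simp only [Set.mem_ofPred_eq, Finset.coe_Icc, Set.mem_Icc, and_congr_right_iff]
    refine fun _ => ⟨fun h => ?_, fun h => (hmono.monotone h).trans h1⟩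
    exact Nat.lt_succ_iff.1 (hmono.lt_iff_lt.1 (h.trans_lt h2))
  rw [eventCount, this, Set.ncard_coe_finset]
  simp

lemma exists_arrivalTime_le_lt
    (htend : Filter.Tendsto (fun n => arrivalTime W n ω) Filter.atTop Filter.atTop) {s : ℝ}
    (hs : 0 ≤ s) : ∃ n, arrivalTime W n ω ≤ s ∧ s < arrivalTime W (n + 1) ω := by
  classical
  have hex : ∃ n, s < arrivalTime W n ω := (htend.eventually_gt_atTop s).exists
  obtain ⟨m, hm⟩ : ∃ m, Nat.find hex = m + 1 :=
    Nat.exists_eq_succ_of_ne_zero fun h => by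
      have := Nat.find_spec hex
      rw [h, arrivalTime_zero] at this
      linarith
  refine ⟨m, not_lt.1 (Nat.find_min hex (by omega)), ?_⟩
  rw [← hm]
  exact Nat.find_spec hex

/-- The integral of a function of the number of events, in terms of the arrival times. -/
lemma integral_comp_eventCount (hpos : ∀ i, 0 < W i ω) (g : ℕ → ℝ) {t : ℝ} (ht : 0 ≤ t) {m : ℕ}
    (hm : t ≤ arrivalTime W m ω) :
    ∫ s in (0 : ℝ)..t, g (eventCount W s ω) =
      ∑ k ∈ Finset.range m,
        g k * (min (arrivalTime W (k + 1) ω) t - min (arrivalTime W k ω) t) := by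
  have hmono := (strictMono_arrivalTime hpos).monotone
  have hle : ∀ k, min (arrivalTime W k ω) t ≤ min (arrivalTime W (k + 1) ω) t := fun k =>
    min_le_min_right _ (hmono k.le_succ)
  -- Truncating at `t` makes the intervals beyond `t` empty. They are open because the count has
  -- already jumped at the right end; the end points are null.
  have hcongr : ∀ k, ∀ s ∈ Set.Ioo (min (arrivalTime W k ω) t) (min (arrivalTime W (k + 1) ω) t),
      g k = g (eventCount W s ω) := by
    intro k s hs
    have h1 : arrivalTime W k ω ≤ s := by
      rcases min_lt_iff.1 hs.1 with h | h
      · exact h.le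
      · linarith [(lt_min_iff.1 hs.2).2]
    rw [eventCount_eq hpos h1 (lt_min_iff.1 hs.2).1]
  have hint : ∀ k < m, IntervalIntegrable (fun s => g (eventCount W s ω)) volume
      (min (arrivalTime W k ω) t) (min (arrivalTime W (k + 1) ω) t) := by
    intro k _
    refine (intervalIntegrable_const (c := g k)).congr_ae ?_
    rw [Set.uIoc_of_le (hle k), ← restrict_Ioo_eq_restrict_Ioc]
    filter_upwards [ae_restrict_mem measurableSet_Ioo] with s hs using hcongr k s hs
  have h := intervalIntegral.sum_integral_adjacent_intervals hint
  rw [arrivalTime_zero, min_eq_left ht, min_eq_right hm] at h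
  rw [← h]
  refine Finset.sum_congr rfl fun k _ => ?_
  rw [intervalIntegral.integral_of_le (hle k), integral_Ioc_eq_integral_Ioo,
    ← setIntegral_congr_fun measurableSet_Ioo (hcongr k), ← integral_Ioc_eq_integral_Ioo,
    ← intervalIntegral.integral_of_le (hle k)]
  simp [mul_comm]

lemma integral_comp_eventCount_eq (hpos : ∀ i, 0 < W i ω) (g : ℕ → ℝ) {t : ℝ} {n : ℕ}
    (h1 : arrivalTime W n ω ≤ t) (h2 : t < arrivalTime W (n + 1) ω) :
    ∫ s in (0 : ℝ)..t, g (eventCount W s ω) =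
      ∑ k ∈ Finset.range n, g k * W k ω + g n * (t - arrivalTime W n ω) := by
  have hmono := (strictMono_arrivalTime hpos).monotone
  rw [integral_comp_eventCount hpos g ((arrivalTime_nonneg hpos n).trans h1) h2.le,
    Finset.sum_range_succ, min_eq_right h2.le, min_eq_left h1]
  congr 1
  refine Finset.sum_congr rfl fun k hk => ?_
  have hk := Finset.mem_range.1 hk
  rw [min_eq_left ((hmono hk).trans h1), min_eq_left ((hmono hk.le).trans h1)]
  change g k * (arrivalTime W (k + 1) ω - arrivalTime W k ω) = _
  rw [arrivalTime_succ]
  ring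

end Path

/-! ### Arithmetic of the direction index modulo 4. -/

section Directions

lemma cos_half_pi_mul_eq_emod (j : ℤ) :
    Real.cos (Real.pi / 2 * (j : ℝ)) = Real.cos (Real.pi / 2 * ((j % 4 : ℤ) : ℝ)) := by
  conv_lhs => rw [← Int.emod_add_mul_ediv j 4]
  conv_rhs => rw [← Real.cos_add_int_mul_two_pi _ (j / 4)]
  congr 1
  push_cast
  ring

lemma sin_half_pi_mul_eq_emod (j : ℤ) :
    Real.sin (Real.pi / 2 * (j : ℝ)) = Real.sin (Real.pi / 2 * ((j % 4 : ℤ) : ℝ)) := by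
  conv_lhs => rw [← Int.emod_add_mul_ediv j 4]
  conv_rhs => rw [← Real.sin_add_int_mul_two_pi _ (j / 4)]
  congr 1
  push_cast
  ring

lemma cos_sin_half_pi_mul (j : ℤ) :
    (j % 4 = 0 ∧ Real.cos (Real.pi / 2 * j) = 1 ∧ Real.sin (Real.pi / 2 * j) = 0) ∨
    (j % 4 = 1 ∧ Real.cos (Real.pi / 2 * j) = 0 ∧ Real.sin (Real.pi / 2 * j) = 1) ∨
    (j % 4 = 2 ∧ Real.cos (Real.pi / 2 * j) = -1 ∧ Real.sin (Real.pi / 2 * j) = 0) ∨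
    (j % 4 = 3 ∧ Real.cos (Real.pi / 2 * j) = 0 ∧ Real.sin (Real.pi / 2 * j) = -1) := by
  have h : j % 4 = 0 ∨ j % 4 = 1 ∨ j % 4 = 2 ∨ j % 4 = 3 := by omega
  have e3 : Real.pi / 2 * ((3 : ℤ) : ℝ) = Real.pi / 2 + Real.pi := by push_cast; ring
  have e2 : Real.pi / 2 * ((2 : ℤ) : ℝ) = Real.pi := by push_cast; ring
  rw [cos_half_pi_mul_eq_emod, sin_half_pi_mul_eq_emod]
  rcases h with h | h | h | h <;> rw [h]
  · simp
  · simp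
  · rw [e2]; simp
  · rw [e3, Real.cos_add_pi, Real.sin_add_pi]; simp

lemma cos_add_sin_half_pi_mul_le (j : ℤ) :
    Real.cos (Real.pi / 2 * j) + Real.sin (Real.pi / 2 * j) ≤ 1 := by
  rcases cos_sin_half_pi_mul j with ⟨_, h, h'⟩ | ⟨_, h, h'⟩ | ⟨_, h, h'⟩ | ⟨_, h, h'⟩ <;>
    rw [h, h'] <;> norm_num

lemma cos_add_sin_half_pi_mul_eq_one_iff (j : ℤ) :
    Real.cos (Real.pi / 2 * j) + Real.sin (Real.pi / 2 * j) = 1 ↔ j % 4 = 0 ∨ j % 4 = 1 := by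
  rcases cos_sin_half_pi_mul j with ⟨h0, h, h'⟩ | ⟨h0, h, h'⟩ | ⟨h0, h, h'⟩ | ⟨h0, h, h'⟩ <;>
    rw [h, h', h0] <;> norm_num

variable {j₀ : ℤ} {e : ℕ → ℤ}

lemma add_sum_alternating {a k : ℕ} (ha : a < 2) (hj : j₀ = a)
    (he : ∀ i < k, e i = (-1) ^ (i + a)) :
    j₀ + ∑ i ∈ Finset.range k, e i = ((k + a) % 2 : ℕ) := by
  induction k with
  | zero => simp [hj]; omega
  | succ k ih =>
    rw [Finset.sum_range_succ, ← add_assoc, ih fun i hi => he i (by omega), he k (by omega)]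
    rcases Nat.even_or_odd (k + a) with h | h
    · rw [h.neg_one_pow]
      obtain ⟨r, hr⟩ := h
      omega
    · rw [h.neg_one_pow]
      obtain ⟨r, hr⟩ := h
      omega

/-- Among the increments `1`, `-1`, `2`, only `+1` keeps residue `0` inside `{0, 1}`, and only `-1`
keeps residue `1` there. Each turn is thus forced by the preceding ones. -/
lemma directions_iff_alternating (hj : j₀ ∈ ({0, 1, 2, 3} : Set ℤ))
    (he : ∀ k, e k = 1 ∨ e k = -1 ∨ e k = 2) (n : ℕ) :
    (∀ k ≤ n, (j₀ + ∑ i ∈ Finset.range k, e i) % 4 = 0 ∨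
      (j₀ + ∑ i ∈ Finset.range k, e i) % 4 = 1) ↔
    ∃ a : Fin 2, j₀ = (a : ℕ) ∧ ∀ k < n, e k = (-1) ^ (k + (a : ℕ)) := by
  constructor
  · intro h
    have h0 := h 0 (Nat.zero_le _)
    simp only [Finset.range_zero, Finset.sum_empty, add_zero] at h0
    simp only [Set.mem_insert_iff, Set.mem_singleton_iff] at hj
    obtain ⟨a, ha⟩ : ∃ a : Fin 2, j₀ = (a : ℕ) := by
      have : j₀ = 0 ∨ j₀ = 1 := by omega
      rcases this with h | h
      · exact ⟨0, by simp [h]⟩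
      · exact ⟨1, by simp [h]⟩
    refine ⟨a, ha, fun k => ?_⟩
    induction k using Nat.strong_induction_on with
    | _ k ih =>
      intro hk
      have hd := add_sum_alternating a.2 ha fun i hi => ih i hi (hi.trans hk)
      have h1 := h (k + 1) hk
      rw [Finset.sum_range_succ, ← add_assoc, hd] at h1
      have h2 := he k
      rcases Nat.even_or_odd (k + a) with h3 | h3
      · rw [h3.neg_one_pow]
        obtain ⟨r, hr⟩ := h3
        omega
      · rw [h3.neg_one_pow]
        obtain ⟨r, hr⟩ := h3
        omega
  · rintro ⟨a, ha, h⟩ k hk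
    rw [add_sum_alternating a.2 ha fun i hi => h i (by omega)]
    omega

lemma cos_sub_sin_half_pi_mul_mod_two (m : ℕ) :
    Real.cos (Real.pi / 2 * (((m % 2 : ℕ) : ℤ) : ℝ)) -
      Real.sin (Real.pi / 2 * (((m % 2 : ℕ) : ℤ) : ℝ)) = (-1) ^ m := by
  rcases Nat.even_or_odd m with h | h
  · rw [h.neg_one_pow, Nat.even_iff.1 h]; simp
  · rw [h.neg_one_pow, Nat.odd_iff.1 h]; simp

end Directions

/-! ### The rotated coordinates `x + y` and `x - y` of the particle. -/

section Displacement

variable {W : ℕ → Ω → ℝ} {E : ℕ → Ω → ℤ} {J₀ : Ω → ℤ} {ω : Ω}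

/-- The waiting times spent, before event `n`, in the direction opposite to the `n`-th one
along a path whose directions alternate. -/
def oppositeIndices (n : ℕ) : Finset ℕ := (Finset.range n).filter fun k => Odd (k + n)

lemma card_oppositeIndices (n : ℕ) : (oppositeIndices n).card = (n + 1) / 2 := by
  induction n using Nat.twoStepInduction with
  | zero => simp [oppositeIndices]
  | one => simp [oppositeIndices, Finset.filter_singleton]
  | more n ih _ =>
    have h1 : (fun k => Odd (k + (n + 2))) = fun k => Odd (k + n) := by
      ext k
      simp [← add_assoc, Nat.odd_add_one]
    have h2 : oppositeIndices (n + 2) = insert (n + 1) (oppositeIndices n) := by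
      ext k
      simp only [oppositeIndices, Finset.mem_filter, Finset.mem_insert, Finset.mem_range,
        Nat.odd_iff]
      omega
    -- Parities are unchanged under `n ↦ n + 2`; of the two new indices `n` and `n + 1`, only the
    -- latter is opposite.
    rw [h2, Finset.card_insert_of_notMem (by simp [oppositeIndices]), ih]
    omega

/-- The waiting times spent before event `n` in the same direction as the `n`-th one. -/
def sameIndices (n : ℕ) : Finset ℕ := (Finset.range n).filter fun k => ¬ Odd (k + n)

lemma card_sameIndices (n : ℕ) : (sameIndices n).card = n / 2 := by
  have := Finset.card_filter_add_card_filter_not (s := Finset.range n) fun k => Odd (k + n)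
  have h := card_oppositeIndices n
  rw [oppositeIndices] at h
  rw [Finset.card_range, h] at this
  rw [sameIndices]
  omega

lemma sum_opposite_add_sum_same (n : ℕ) :
    ∑ i ∈ oppositeIndices n, W i ω + ∑ i ∈ sameIndices n, W i ω = arrivalTime W n ω :=
  Finset.sum_filter_add_sum_filter_not _ _ _

/-- The position at time `t` in terms of the directions and the waiting times. -/
lemma integral_direction_eq (G : ℤ → ℝ) (hpos : ∀ i, 0 < W i ω) {t : ℝ} {n : ℕ}
    (h1 : arrivalTime W n ω ≤ t) (h2 : t < arrivalTime W (n + 1) ω) :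
    ∫ s in (0 : ℝ)..t, G (dirIndex J₀ W E s ω) =
      ∑ k ∈ Finset.range n, G (J₀ ω + ∑ i ∈ Finset.range k, E i ω) * W k ω +
        G (J₀ ω + ∑ i ∈ Finset.range n, E i ω) * (t - arrivalTime W n ω) :=
  integral_comp_eventCount_eq hpos (fun k => G (J₀ ω + ∑ i ∈ Finset.range k, E i ω)) h1 h2

/-- The defect `ct - (X + Y)` is a sum of nonnegative terms, one for each stretch between events, so
it vanishes only if each term does. Strictness in `h1` gives the last stretch positive length;
otherwise the last direction would be unconstrained. -/
lemma posX_add_posY_eq_iff {c : ℝ} (hc : 0 < c) (hpos : ∀ i, 0 < W i ω) {t : ℝ} {n : ℕ}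
    (h1 : arrivalTime W n ω < t) (h2 : t < arrivalTime W (n + 1) ω) :
    posX c J₀ W E t ω + posY c J₀ W E t ω = c * t ↔
      ∀ k ≤ n, (J₀ ω + ∑ i ∈ Finset.range k, E i ω) % 4 = 0 ∨
        (J₀ ω + ∑ i ∈ Finset.range k, E i ω) % 4 = 1 := by
  have hX : posX c J₀ W E t ω = _ := integral_direction_eq
    (fun j => c * Real.cos (Real.pi / 2 * (j : ℝ))) hpos h1.le h2
  have hY : posY c J₀ W E t ω = _ := integral_direction_eq
    (fun j => c * Real.sin (Real.pi / 2 * (j : ℝ))) hpos h1.le h2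
  set d : ℕ → ℤ := fun k => J₀ ω + ∑ i ∈ Finset.range k, E i ω with hd
  set v : ℕ → ℝ := fun k => 1 - (Real.cos (Real.pi / 2 * (d k : ℝ)) +
    Real.sin (Real.pi / 2 * (d k : ℝ))) with hv
  have hv0 : ∀ k, 0 ≤ v k := fun k => by
    have := cos_add_sin_half_pi_mul_le (d k)
    simp only [hv]; linarith
  have hsum : c * t - (posX c J₀ W E t ω + posY c J₀ W E t ω) =
      c * (∑ k ∈ Finset.range n, v k * W k ω + v n * (t - arrivalTime W n ω)) := by
    rw [hX, hY]
    have ht : t = ∑ k ∈ Finset.range n, W k ω + (t - arrivalTime W n ω) := by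
      simp [arrivalTime]
    have e1 : ∑ k ∈ Finset.range n, v k * W k ω = ∑ k ∈ Finset.range n, W k ω -
        (∑ k ∈ Finset.range n, Real.cos (Real.pi / 2 * (d k : ℝ)) * W k ω +
          ∑ k ∈ Finset.range n, Real.sin (Real.pi / 2 * (d k : ℝ)) * W k ω) := by
      rw [← Finset.sum_add_distrib, ← Finset.sum_sub_distrib]
      refine Finset.sum_congr rfl fun k _ => ?_
      simp only [hv]; ring
    simp only [mul_assoc, ← Finset.mul_sum]
    rw [e1]
    simp only [hv]
    nth_rewrite 1 [ht]
    ring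
  have hiff : posX c J₀ W E t ω + posY c J₀ W E t ω = c * t ↔
      ∑ k ∈ Finset.range n, v k * W k ω + v n * (t - arrivalTime W n ω) = 0 := by
    rw [eq_comm, ← sub_eq_zero, hsum, mul_eq_zero, or_iff_right hc.ne']
  have hvk : ∀ k, v k = 0 ↔ d k % 4 = 0 ∨ d k % 4 = 1 := fun k => by
    rw [← cos_add_sin_half_pi_mul_eq_one_iff, hv, sub_eq_zero, eq_comm]
  rw [hiff, add_eq_zero_iff_of_nonneg
    (Finset.sum_nonneg fun k _ => mul_nonneg (hv0 k) (hpos k).le)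
    (mul_nonneg (hv0 n) (by linarith)),
    Finset.sum_eq_zero_iff_of_nonneg fun k _ => mul_nonneg (hv0 k) (hpos k).le,
    mul_eq_zero, or_iff_left (by linarith), hvk]
  constructor
  · rintro ⟨h, h'⟩ k hk
    rcases hk.lt_or_eq with hk | rfl
    · exact (hvk k).1 ((mul_eq_zero.1 (h k (Finset.mem_range.2 hk))).resolve_right (hpos k).ne')
    · exact h'
  · intro h
    refine ⟨fun k hk => ?_, h n le_rfl⟩
    rw [(hvk k).2 (h k (Finset.mem_range.1 hk).le), zero_mul]

/-- On the `k`-th stretch `x - y` has velocity `c (-1)^(k + a)`. Factoring out the last sign leaves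
the time in the last direction minus the time in the opposite one. -/
lemma posX_sub_posY_eq {c : ℝ} (hpos : ∀ i, 0 < W i ω) {t : ℝ} {n : ℕ}
    (h1 : arrivalTime W n ω ≤ t) (h2 : t < arrivalTime W (n + 1) ω) {a : ℕ} (ha : a < 2)
    (hj : J₀ ω = a) (he : ∀ k < n, E k ω = (-1) ^ (k + a)) :
    posX c J₀ W E t ω - posY c J₀ W E t ω =
      c * (-1) ^ (n + a) * (t - 2 * ∑ i ∈ oppositeIndices n, W i ω) := by
  have hX : posX c J₀ W E t ω = _ := integral_direction_eq
    (fun j => c * Real.cos (Real.pi / 2 * (j : ℝ))) hpos h1 h2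
  have hY : posY c J₀ W E t ω = _ := integral_direction_eq
    (fun j => c * Real.sin (Real.pi / 2 * (j : ℝ))) hpos h1 h2
  have hdir : ∀ k ≤ n, J₀ ω + ∑ i ∈ Finset.range k, E i ω = ((k + a) % 2 : ℕ) := fun k hk =>
    add_sum_alternating ha hj fun i hi => he i (by omega)
  have hsum : ∑ k ∈ Finset.range n, (-1 : ℝ) ^ (k + a) * W k ω =
      (-1) ^ (n + a) * (arrivalTime W n ω - 2 * ∑ i ∈ oppositeIndices n, W i ω) := by
    have e : ∑ k ∈ Finset.range n, (-1 : ℝ) ^ (k + a) * W k ω =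
        (-1) ^ (n + a) * ∑ k ∈ Finset.range n, (-1 : ℝ) ^ (k + n) * W k ω := by
      rw [Finset.mul_sum]
      refine Finset.sum_congr rfl fun k _ => ?_
      rw [← mul_assoc, ← pow_add]
      congr 1
      rw [show n + a + (k + n) = k + a + 2 * n by ring, pow_add _ (k + a), pow_mul]
      simp
    have e1 : ∑ k ∈ oppositeIndices n, (-1 : ℝ) ^ (k + n) * W k ω =
        -∑ k ∈ oppositeIndices n, W k ω := by
      rw [← Finset.sum_neg_distrib]
      refine Finset.sum_congr rfl fun k hk => ?_
      rw [(Finset.mem_filter.1 hk).2.neg_one_pow, neg_one_mul]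
    have e2 : ∑ k ∈ sameIndices n, (-1 : ℝ) ^ (k + n) * W k ω = ∑ k ∈ sameIndices n, W k ω := by
      refine Finset.sum_congr rfl fun k hk => ?_
      rw [(Nat.not_odd_iff_even.1 (Finset.mem_filter.1 hk).2).neg_one_pow, one_mul]
    rw [e, ← Finset.sum_filter_add_sum_filter_not _ fun k => Odd (k + n)]
    change _ * (∑ k ∈ oppositeIndices n, _ + ∑ k ∈ sameIndices n, _) = _
    rw [e1, e2, ← sum_opposite_add_sum_same n]
    ring
  rw [hX, hY, hdir n le_rfl]
  have e3 : ∀ f : ℝ → ℝ, ∑ k ∈ Finset.range n,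
      c * f (Real.pi / 2 * ((J₀ ω + ∑ i ∈ Finset.range k, E i ω : ℤ) : ℝ)) * W k ω =
      c * ∑ k ∈ Finset.range n, f (Real.pi / 2 * (((k + a) % 2 : ℕ) : ℤ)) * W k ω := by
    intro f
    rw [Finset.mul_sum]
    refine Finset.sum_congr rfl fun k hk => ?_
    rw [hdir k (Finset.mem_range.1 hk).le]
    ring
  rw [e3, e3]
  have e4 : ∑ k ∈ Finset.range n, Real.cos (Real.pi / 2 * (((k + a) % 2 : ℕ) : ℤ)) * W k ω -
      ∑ k ∈ Finset.range n, Real.sin (Real.pi / 2 * (((k + a) % 2 : ℕ) : ℤ)) * W k ω =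
      ∑ k ∈ Finset.range n, (-1 : ℝ) ^ (k + a) * W k ω := by
    rw [← Finset.sum_sub_distrib]
    refine Finset.sum_congr rfl fun k _ => ?_
    rw [← sub_mul, cos_sub_sin_half_pi_mul_mod_two]
  have e5 := cos_sub_sin_half_pi_mul_mod_two (n + a)
  rw [hsum] at e4
  linear_combination c * e4 + c * (t - arrivalTime W n ω) * e5

end Displacement

/-! ### The Bessel series and its expansion by number of events. -/

section Bessel

/-- The entire function `z ↦ ∑ zᵏ / (k!)²`, so that `I₀ x = besselSeries ((x / 2) ^ 2)`. -/
def besselSeries (z : ℝ) : ℝ := ∑' k : ℕ, z ^ k / ((k.factorial : ℝ) ^ 2)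

/-- The derivative of `besselSeries`. -/
def besselSeriesDeriv (z : ℝ) : ℝ :=
  ∑' k : ℕ, z ^ k / ((k.factorial : ℝ) * ((k + 1).factorial : ℝ))

lemma one_le_factorial (k : ℕ) : (1 : ℝ) ≤ (k.factorial : ℝ) := by
  exact_mod_cast Nat.one_le_iff_ne_zero.2 k.factorial_ne_zero

lemma summable_pow_div_mul_of_one_le (z : ℝ) {b : ℕ → ℝ} (hb : ∀ k, 1 ≤ b k) :
    Summable fun k : ℕ => z ^ k / ((k.factorial : ℝ) * b k) := by
  refine Summable.of_norm_bounded (Real.summable_pow_div_factorial |z|) fun k => ?_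
  have h1 := one_le_factorial k
  have h2 := hb k
  rw [Real.norm_eq_abs, abs_div, abs_pow,
    abs_of_nonneg (by positivity : 0 ≤ (k.factorial : ℝ) * b k)]
  gcongr
  nlinarith

lemma summable_besselSeries (z : ℝ) : Summable fun k : ℕ => z ^ k / ((k.factorial : ℝ) ^ 2) := by
  simpa [sq] using summable_pow_div_mul_of_one_le z one_le_factorial

lemma summable_besselSeriesDeriv (z : ℝ) :
    Summable fun k : ℕ => z ^ k / ((k.factorial : ℝ) * ((k + 1).factorial : ℝ)) :=
  summable_pow_div_mul_of_one_le z fun k => one_le_factorial (k + 1)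

lemma hasDerivAt_besselSeries (z : ℝ) : HasDerivAt besselSeries (besselSeriesDeriv z) z := by
  -- Termwise differentiation takes place on a ball containing both `z` and `0`, where the
  -- derivatives are dominated by their values at `R`.
  set R : ℝ := |z| + 1 with hR
  have hR0 : 0 < R := by positivity
  have hu : Summable fun k : ℕ => k * R ^ (k - 1) / ((k.factorial : ℝ) ^ 2) := by
    rw [← summable_nat_add_iff 1]
    refine (summable_besselSeriesDeriv R).congr fun k => ?_
    rw [Nat.factorial_succ]
    push_cast
    field_simp
  have h := hasDerivAt_tsum_of_isPreconnected (y₀ := 0) (y := z)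
    (g := fun (k : ℕ) (x : ℝ) => x ^ k / ((k.factorial : ℝ) ^ 2))
    (g' := fun (k : ℕ) (x : ℝ) => k * x ^ (k - 1) / ((k.factorial : ℝ) ^ 2))
    hu Metric.isOpen_ball (convex_ball (0 : ℝ) R).isPreconnected
    (fun k y _ => (hasDerivAt_pow k y).div_const _)
    (fun k y hy => by
      rw [Real.norm_eq_abs, abs_div, abs_mul, abs_pow, Nat.abs_cast,
        abs_of_nonneg (sq_nonneg (k.factorial : ℝ))]
      have : |y| ≤ R := by simpa using (Metric.mem_ball.1 hy).le
      gcongr)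
    (by simpa using hR0) (summable_besselSeries 0) (by simp [hR])
  convert! h using 1
  have hs : Summable fun k : ℕ => k * z ^ (k - 1) / ((k.factorial : ℝ) ^ 2) := by
    rw [← summable_nat_add_iff 1]
    refine (summable_besselSeriesDeriv z).congr fun k => ?_
    rw [Nat.factorial_succ]
    push_cast
    field_simp
  rw [hs.tsum_eq_zero_add, besselSeriesDeriv]
  simp only [Nat.cast_zero, zero_mul, zero_div, zero_add]
  refine tsum_congr fun k => ?_
  rw [Nat.factorial_succ]
  push_cast
  field_simp

variable {c lam p q η : ℝ}

/-- The squared half argument of the Bessel function. -/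
def halfArgSq (c lam p q η s : ℝ) : ℝ :=
  lam ^ 2 * (p * q) * ((c ^ 2 * s ^ 2 - η ^ 2) / (4 * c ^ 2))

lemma besselProfile_eq (hpq : 0 ≤ p * q) {s : ℝ} (hs : 0 ≤ c ^ 2 * s ^ 2 - η ^ 2) :
    besselProfile c lam p q η s = besselSeries (halfArgSq c lam p q η s) := by
  rw [besselProfile, besselI0, besselSeries]
  refine tsum_congr fun k => ?_
  rw [pow_mul, div_pow, mul_pow, mul_pow, Real.sq_sqrt hpq, Real.sq_sqrt hs]
  congr 2
  rw [halfArgSq]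
  ring

/-- Only even powers occur in `I₀`, so the square roots disappear as long as the radicand is
nonnegative. It is positive at `t`, hence near `t`, and the profile is locally the entire series at
a polynomial in time. -/
lemma hasDerivAt_besselProfile (hc : 0 < c) (hpq : 0 ≤ p * q) {t : ℝ} (hη : |η| < c * t) :
    HasDerivAt (fun s => besselProfile c lam p q η s)
      (besselSeriesDeriv (halfArgSq c lam p q η t) * (lam ^ 2 * (p * q) * (t / 2))) t := by
  have h1 : HasDerivAt (fun s => halfArgSq c lam p q η s) (lam ^ 2 * (p * q) * (t / 2)) t := by
    unfold halfArgSq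
    have := ((((hasDerivAt_pow 2 t).const_mul (c ^ 2)).sub_const (η ^ 2)).div_const
      (4 * c ^ 2)).const_mul (lam ^ 2 * (p * q))
    convert! this using 2
    push_cast
    field_simp
    ring
  refine ((hasDerivAt_besselSeries _).comp t h1).congr_of_eventuallyEq ?_
  have hcont : Filter.Tendsto (fun s => c ^ 2 * s ^ 2 - η ^ 2) (nhds t)
      (nhds (c ^ 2 * t ^ 2 - η ^ 2)) := Continuous.tendsto (by fun_prop) t
  have hpos : 0 < c ^ 2 * t ^ 2 - η ^ 2 := by
    rw [← mul_pow, sub_pos]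
    exact sq_lt_sq' (by linarith [neg_abs_le η]) (by linarith [le_abs_self η])
  filter_upwards [hcont.eventually (lt_mem_nhds hpos)] with s hs
  exact besselProfile_eq hpq hs.le

/-- The defective density of the time in one of two alternating directions, seen from the
position `η`, for `n` events. -/
def pieceDensity (c lam t : ℝ) (n : ℕ) (x : ℝ) : ℝ :=
  lam ^ n * Real.exp (-(lam * t)) * x ^ ((n - 1) / 2) * (t - x) ^ (n / 2) /
    ((((n - 1) / 2).factorial : ℝ) * ((n / 2).factorial : ℝ)) / (2 * c)

/-- The probability of the `n` turns of an alternating path that starts in direction `a`. -/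
def turnWeight (p q : ℝ) (n a : ℕ) : ℝ :=
  if a = 0 then p ^ ((n + 1) / 2) * q ^ (n / 2) else q ^ ((n + 1) / 2) * p ^ (n / 2)

/-- The time spent in the direction opposite to the last one, when `x - y = η`. -/
def oppositeTime (c t : ℝ) (n a : ℕ) (η : ℝ) : ℝ := (t - (-1) ^ (n + a) * η / c) / 2

lemma hasSum_sideDensity (hc : 0 < c) (hp : 0 ≤ p) (hq : 0 ≤ q) {t : ℝ}
    (hη : |η| < c * t) :
    HasSum (fun i : ℕ => ∑ a : Fin 2, 1 / 4 * turnWeight p q (i + 1) a *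
      pieceDensity c lam t (i + 1) (oppositeTime c t (i + 1) a η)) (sideDensity c lam p q η t) := by
  have hpq := mul_nonneg hp hq
  have hpos : 0 < c ^ 2 * t ^ 2 - η ^ 2 := by
    rw [← mul_pow, sub_pos]
    exact sq_lt_sq' (by linarith [neg_abs_le η]) (by linarith [le_abs_self η])
  rw [sideDensity, (hasDerivAt_besselProfile hc hpq hη).deriv, besselProfile_eq hpq hpos.le,
    mul_add, neg_mul]
  set z := halfArgSq c lam p q η t with hz
  set u : ℝ := (c ^ 2 * t ^ 2 - η ^ 2) / (4 * c ^ 2) with hu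
  have hzu : ∀ m, z ^ m = lam ^ (2 * m) * (p ^ m * q ^ m) * u ^ m := fun m => by
    rw [hz, halfArgSq, mul_pow, mul_pow, mul_pow, pow_mul]
  have hu1 : (t - η / c) / 2 * (t - (t - η / c) / 2) = u := by
    rw [hu]; field_simp; ring
  have hu2 : (t - -η / c) / 2 * (t - (t - -η / c) / 2) = u := by
    rw [hu]; field_simp; ring
  have h1 := ((summable_besselSeries z).hasSum.mul_left
    (Real.exp (-(lam * t)) / (4 * c) * (lam * (p + q) / 2)))
  have h2 := ((summable_besselSeriesDeriv z).hasSum.mul_left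
    (Real.exp (-(lam * t)) / (4 * c) * (lam ^ 2 * (p * q) * (t / 2))))
  -- The summation index is `i = n - 1`: even `i` means an odd number of events and yields the `I₀`
  -- term, odd `i` yields the derivative term.
  convert! HasSum.even_add_odd (f := fun i : ℕ => ∑ a : Fin 2, 1 / 4 * turnWeight p q (i + 1) a *
      pieceDensity c lam t (i + 1) (oppositeTime c t (i + 1) a η))
      (h1.congr_fun ?_) (h2.congr_fun ?_) using 1
  · rw [besselSeries, besselSeriesDeriv]
    ring
  · intro m
    have e1 : (2 * m + 1 - 1) / 2 = m := by omega
    have e2 : (2 * m + 1) / 2 = m := by omega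
    have e3 : (2 * m + 1 + 1) / 2 = m + 1 := by omega
    simp only [Fin.sum_univ_two, turnWeight, pieceDensity, oppositeTime, e1, e2, e3, Fin.val_zero,
      Fin.val_one, if_true, one_ne_zero, if_false, hzu]
    have o1 : (-1 : ℝ) ^ (2 * m + 1 + 0) = -1 := by simp [pow_add, pow_mul]
    have o2 : (-1 : ℝ) ^ (2 * m + 1 + 1) = 1 := by simp [pow_add, pow_mul]
    rw [o1, o2, one_mul, neg_one_mul]
    have hu1' : ((t - η / c) / 2) ^ m * (t - (t - η / c) / 2) ^ m = u ^ m := by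
      rw [← mul_pow, hu1]
    have hu2' : ((t - -η / c) / 2) ^ m * (t - (t - -η / c) / 2) ^ m = u ^ m := by
      rw [← mul_pow, hu2]
    rw [mul_assoc _ (_ ^ m) (_ ^ m), mul_assoc _ (_ ^ m) (_ ^ m), hu1', hu2']
    field_simp
    ring
  · intro m
    have e1 : (2 * m + 1 + 1 - 1) / 2 = m := by omega
    have e2 : (2 * m + 1 + 1) / 2 = m + 1 := by omega
    have e3 : (2 * m + 1 + 1 + 1) / 2 = m + 1 := by omega
    simp only [Fin.sum_univ_two, turnWeight, pieceDensity, oppositeTime, e1, e2, e3, Fin.val_zero,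
      Fin.val_one, if_true, one_ne_zero, if_false, hzu]
    have o1 : (-1 : ℝ) ^ (2 * m + 1 + 1 + 0) = 1 := by simp [pow_add, pow_mul]
    have o2 : (-1 : ℝ) ^ (2 * m + 1 + 1 + 1) = -1 := by simp [pow_add, pow_mul]
    rw [o1, o2, one_mul, neg_one_mul]
    -- Pair the `m` factors `x` with `m` factors `t - x` and keep the extra `t - x`; over the two
    -- starts these extras sum to `t`.
    have hu1' : ∀ K, K * ((t - η / c) / 2) ^ m * (t - (t - η / c) / 2) ^ (m + 1) =
        K * u ^ m * (t - (t - η / c) / 2) := fun K => by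
      rw [← hu1, mul_pow, pow_succ]
      ring
    have hu2' : ∀ K, K * ((t - -η / c) / 2) ^ m * (t - (t - -η / c) / 2) ^ (m + 1) =
        K * u ^ m * (t - (t - -η / c) / 2) := fun K => by
      rw [← hu2, mul_pow, pow_succ]
      ring
    rw [hu1', hu2']
    field_simp
    ring

lemma pieceDensity_nonneg (hc : 0 < c) (hlam : 0 < lam) {t x : ℝ} (hx : 0 ≤ x) (hxt : x ≤ t)
    (n : ℕ) : 0 ≤ pieceDensity c lam t n x := by
  have : 0 ≤ t - x := by linarith
  unfold pieceDensity
  positivity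

lemma turnWeight_nonneg (hp : 0 ≤ p) (hq : 0 ≤ q) (n a : ℕ) : 0 ≤ turnWeight p q n a := by
  unfold turnWeight
  split_ifs <;> positivity

lemma oppositeTime_mem_Ioo (hc : 0 < c) {t : ℝ} (hη : |η| < c * t) (n a : ℕ) :
    oppositeTime c t n a η ∈ Set.Ioo 0 t := by
  have h1 : |(-1) ^ (n + a) * η / c| < t := by
    rw [abs_div, abs_mul, abs_pow, abs_neg, abs_one, one_pow, one_mul, abs_of_pos hc,
      div_lt_iff₀ hc]
    linarith
  rw [abs_lt] at h1
  unfold oppositeTime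
  constructor <;> linarith

end Bessel

/-! ### Decomposition of the side event by number of turns and initial direction. -/

section AlternatingPath

variable {c : ℝ} {J₀ : Ω → ℤ} {W : ℕ → Ω → ℝ} {E : ℕ → Ω → ℤ}

/-- The event that the path starts in direction `a`, alternates between the two directions of one
side of the square, changes direction `n` times before `t` and spends a time in `C` in the
direction opposite to the last one. -/
def alternatingEvent (J₀ : Ω → ℤ) (W : ℕ → Ω → ℝ) (E : ℕ → Ω → ℤ) (t : ℝ) (n a : ℕ)
    (C : Set ℝ) : Set Ω :=
  {ω | J₀ ω = a} ∩ ({ω | ∑ i ∈ oppositeIndices n, W i ω ∈ C ∧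
      ∑ i ∈ sameIndices n, W i ω ≤ t - ∑ i ∈ oppositeIndices n, W i ω ∧
      t - ∑ i ∈ oppositeIndices n, W i ω < ∑ i ∈ sameIndices n, W i ω + W n ω} ∩
    {ω | ∀ k < n, E k ω = (-1) ^ (k + a)})

/-- The path properties that hold almost surely. -/
structure IsRegularPath (J₀ : Ω → ℤ) (W : ℕ → Ω → ℝ) (E : ℕ → Ω → ℤ) (t : ℝ) (ω : Ω) : Prop where
  waiting_pos : ∀ i, 0 < W i ω
  arrival_ne : ∀ n, arrivalTime W n ω ≠ t
  arrival_tendsto : Filter.Tendsto (fun n => arrivalTime W n ω) Filter.atTop Filter.atTop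
  initial_mem : J₀ ω ∈ ({0, 1, 2, 3} : Set ℤ)
  turn_mem : ∀ k, E k ω = 1 ∨ E k ω = -1 ∨ E k ω = 2

/-- The event is defined through sums over disjoint index sets, which suits independence; the path
arguments need arrival times instead. -/
lemma mem_alternatingEvent_iff {t : ℝ} {n a : ℕ} {C : Set ℝ} {ω : Ω} :
    ω ∈ alternatingEvent J₀ W E t n a C ↔ J₀ ω = a ∧ (∀ k < n, E k ω = (-1) ^ (k + a)) ∧
      ∑ i ∈ oppositeIndices n, W i ω ∈ C ∧ arrivalTime W n ω ≤ t ∧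
      t < arrivalTime W (n + 1) ω := by
  have h := sum_opposite_add_sum_same (W := W) (ω := ω) n
  have h1 : ∑ i ∈ sameIndices n, W i ω ≤ t - ∑ i ∈ oppositeIndices n, W i ω ↔
      arrivalTime W n ω ≤ t := by
    constructor <;> intro _ <;> linarith
  have h2 : t - ∑ i ∈ oppositeIndices n, W i ω < ∑ i ∈ sameIndices n, W i ω + W n ω ↔
      t < arrivalTime W (n + 1) ω := by
    rw [arrivalTime_succ]
    constructor <;> intro _ <;> linarith
  change (J₀ ω = a ∧ (_ ∧ _ ∧ _) ∧ (∀ k < n, E k ω = (-1) ^ (k + a))) ↔ _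
  rw [h1, h2]
  tauto

lemma event_iff_exists_alternatingEvent (hc : 0 < c) {t : ℝ} (ht : 0 < t) {B : Set ℝ}
    (hB : B ⊆ Set.Ioo (-(c * t)) (c * t)) {ω : Ω} (hω : IsRegularPath J₀ W E t ω) :
    (posX c J₀ W E t ω + posY c J₀ W E t ω = c * t ∧
      posX c J₀ W E t ω - posY c J₀ W E t ω ∈ B) ↔
    ∃ i : ℕ × Fin 2, ω ∈ alternatingEvent J₀ W E t (i.1 + 1) i.2
      {x | c * (-1) ^ (i.1 + 1 + (i.2 : ℕ)) * (t - 2 * x) ∈ B} := by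
  constructor
  · rintro ⟨h1, h2⟩
    obtain ⟨n, hn1, hn2⟩ := exists_arrivalTime_le_lt hω.arrival_tendsto ht.le
    rw [posX_add_posY_eq_iff hc hω.waiting_pos (hn1.lt_of_ne (hω.arrival_ne n)) hn2,
      directions_iff_alternating hω.initial_mem hω.turn_mem] at h1
    obtain ⟨a, ha, he⟩ := h1
    rw [posX_sub_posY_eq hω.waiting_pos hn1 hn2 a.2 ha he] at h2
    cases n with
    | zero =>
      -- Without a turn `X - Y = ±ct`, which lies outside the open interval containing `B`.
      exfalso
      have h3 := hB h2
      simp only [oppositeIndices, Finset.range_zero, Finset.filter_empty, Finset.sum_empty,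
        mul_zero, sub_zero] at h3
      rcases neg_one_pow_eq_or ℝ (0 + (a : ℕ)) with h | h <;> rw [h] at h3 <;>
        obtain ⟨h4, h5⟩ := h3 <;> linarith
    | succ m => exact ⟨(m, a), mem_alternatingEvent_iff.2 ⟨ha, he, h2, hn1, hn2⟩⟩
  · rintro ⟨⟨m, a⟩, h⟩
    obtain ⟨ha, he, h2, hn1, hn2⟩ := mem_alternatingEvent_iff.1 h
    rw [posX_add_posY_eq_iff hc hω.waiting_pos (hn1.lt_of_ne (hω.arrival_ne _)) hn2,
      directions_iff_alternating hω.initial_mem hω.turn_mem,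
      posX_sub_posY_eq hω.waiting_pos hn1 hn2 a.2 ha he]
    exact ⟨⟨a, ha, he⟩, h2⟩

lemma eq_of_mem_alternatingEvent {t : ℝ} {ω : Ω} (hω : IsRegularPath J₀ W E t ω)
    {n n' : ℕ} {a a' : Fin 2} {C C' : Set ℝ} (h : ω ∈ alternatingEvent J₀ W E t n a C)
    (h' : ω ∈ alternatingEvent J₀ W E t n' a' C') : n = n' ∧ a = a' := by
  obtain ⟨h1, -, -, h2, h3⟩ := mem_alternatingEvent_iff.1 h
  obtain ⟨h1', -, -, h2', h3'⟩ := mem_alternatingEvent_iff.1 h'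
  refine ⟨?_, ?_⟩
  · rw [← eventCount_eq hω.waiting_pos h2 h3, eventCount_eq hω.waiting_pos h2' h3']
  · rw [h1] at h1'
    exact Fin.ext (by exact_mod_cast h1')

lemma dirIndex_congr {J₀' : Ω → ℤ} {W' : ℕ → Ω → ℝ} {E' : ℕ → Ω → ℤ} {ω : Ω}
    (hJ : J₀ ω = J₀' ω) (hW : ∀ i, W i ω = W' i ω) (hE : ∀ i, E i ω = E' i ω) (s : ℝ) :
    dirIndex J₀ W E s ω = dirIndex J₀' W' E' s ω := by
  simp only [dirIndex, eventCount, arrivalTime, hJ, hW, hE]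

end AlternatingPath

/-! ### Probabilities of the pieces and their sum. -/

section Driving

variable [MeasurableSpace Ω] {P : Measure Ω} {c lam p q : ℝ} {J₀ : Ω → ℤ} {W : ℕ → Ω → ℝ}
  {E : ℕ → Ω → ℤ}

lemma turnLaw_neg_one_pow (p q : ℝ) (m : ℕ) :
    turnLaw p q {(-1) ^ m} = ENNReal.ofReal (if Even m then p else q) := by
  rcases Nat.even_or_odd m with h | h
  · simp [turnLaw, h.neg_one_pow, h]
  · simp [turnLaw, h.neg_one_pow, Nat.not_even_iff_odd.2 h]

lemma prod_turn_eq_turnWeight (p q : ℝ) (n : ℕ) (a : Fin 2) :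
    ∏ k ∈ Finset.range n, (if Even (k + (a : ℕ)) then p else q) = turnWeight p q n a := by
  induction n using Nat.twoStepInduction with
  | zero => fin_cases a <;> simp [turnWeight]
  | one => fin_cases a <;> simp [turnWeight]
  | more n ih _ =>
    rw [Finset.prod_range_succ, Finset.prod_range_succ, ih]
    have e1 : (n + 2 + 1) / 2 = (n + 1) / 2 + 1 := by omega
    have e2 : (n + 2) / 2 = n / 2 + 1 := by omega
    simp only [turnWeight, e1, e2, pow_succ, add_right_comm n 1 (a : ℕ), Nat.even_add_one]
    split_ifs <;> ring

lemma measure_turns_eq (hp : 0 ≤ p) (hq : 0 ≤ q) (hd : IsDriving P lam p q J₀ W E)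
    (n : ℕ) (a : Fin 2) :
    P {ω | ∀ k < n, E k ω = (-1) ^ (k + (a : ℕ))} = ENNReal.ofReal (turnWeight p q n a) := by
  have h := hd.turn_indep.measure_inter_preimage_eq_mul (Finset.range n)
    (sets := fun k => {(-1) ^ (k + (a : ℕ))}) fun k _ => measurableSet_singleton _
  have hset : {ω | ∀ k < n, E k ω = (-1) ^ (k + (a : ℕ))} =
      ⋂ k ∈ Finset.range n, E k ⁻¹' {(-1) ^ (k + (a : ℕ))} := by
    ext ω
    simp
  rw [hset, h, ← prod_turn_eq_turnWeight, ENNReal.ofReal_prod_of_nonneg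
    fun k _ => by split_ifs <;> assumption]
  refine Finset.prod_congr rfl fun k _ => ?_
  rw [← turnLaw_neg_one_pow, ← (hd.turn_law k).map_eq,
    Measure.map_apply_of_aemeasurable (hd.turn_law k).aemeasurable (measurableSet_singleton _)]

lemma uniformOn_direction (a : Fin 2) :
    uniformOn ({0, 1, 2, 3} : Set ℤ) {((a : ℕ) : ℤ)} = ENNReal.ofReal (1 / 4) := by
  have h := uniformOn_apply_finset (s := ({0, 1, 2, 3} : Finset ℤ)) (t := {((a : ℕ) : ℤ)})
  push_cast at h
  rw [h]
  have : (({0, 1, 2, 3} : Finset ℤ) ∩ {((a : ℕ) : ℤ)}).card = 1 := by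
    fin_cases a <;> rfl
  rw [this, show ({0, 1, 2, 3} : Finset ℤ).card = 4 from rfl,
    ENNReal.ofReal_div_of_pos (by norm_num)]
  simp

lemma measurableSet_waiting (n : ℕ) (t : ℝ) {C : Set ℝ} (hC : MeasurableSet C) :
    MeasurableSet {w : ℕ → ℝ | ∑ i ∈ oppositeIndices n, w i ∈ C ∧
      ∑ i ∈ sameIndices n, w i ≤ t - ∑ i ∈ oppositeIndices n, w i ∧
      t - ∑ i ∈ oppositeIndices n, w i < ∑ i ∈ sameIndices n, w i + w n} := by
  have hs : ∀ s : Finset ℕ, Measurable fun w : ℕ → ℝ => ∑ i ∈ s, w i := fun s => by fun_prop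
  exact (hC.preimage (hs _)).inter ((measurableSet_le (hs _) ((hs _).const_sub t)).inter
    (measurableSet_lt ((hs _).const_sub t) ((hs _).add (measurable_pi_apply n))))

lemma measurableSet_turns (n a : ℕ) :
    MeasurableSet {e : ℕ → ℤ | ∀ k < n, e k = (-1) ^ (k + a)} := by
  simp only [Set.ofPred_forall]
  exact MeasurableSet.iInter fun k => MeasurableSet.iInter fun _ =>
    measurableSet_eq_fun (measurable_pi_apply k) measurable_const

lemma measurableSet_alternatingEvent (hJm : Measurable J₀) (hWm : ∀ i, Measurable (W i))
    (hEm : ∀ i, Measurable (E i)) (t : ℝ) (n a : ℕ) {C : Set ℝ} (hC : MeasurableSet C) :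
    MeasurableSet (alternatingEvent J₀ W E t n a C) :=
  (hJm (measurableSet_singleton _)).inter
    (((measurable_pi_lambda (fun ω n => W n ω) hWm) (measurableSet_waiting n t hC)).inter
      ((measurable_pi_lambda (fun ω n => E n ω) hEm) (measurableSet_turns n a)))

/-- The three constraints bear on the initial direction, the waiting times and the turns separately,
so the probability factorises. With `n ≥ 1` at least one waiting time is opposite, so its sum has a
density. -/
lemma measure_alternatingEvent [IsProbabilityMeasure P] (hlam : 0 < lam) (hp : 0 ≤ p) (hq : 0 ≤ q)
    (hd : IsDriving P lam p q J₀ W E) (hWm : ∀ i, Measurable (W i)) (t : ℝ) {n : ℕ} (hn : 1 ≤ n)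
    (a : Fin 2) {C : Set ℝ} (hC : MeasurableSet C) (hCt : C ⊆ Set.Ioo 0 t) :
    P (alternatingEvent J₀ W E t n a C) =
      ENNReal.ofReal (1 / 4 * turnWeight p q n a) *
      ∫⁻ x in C, ENNReal.ofReal (lam ^ n * Real.exp (-(lam * t)) * x ^ ((n - 1) / 2) *
        (t - x) ^ (n / 2) / ((((n - 1) / 2).factorial : ℝ) * ((n / 2).factorial : ℝ))) := by
  have h1 := hd.initial_indep.measure_inter_preimage_eq_mul {((a : ℕ) : ℤ)}
    ({w : ℕ → ℝ | ∑ i ∈ oppositeIndices n, w i ∈ C ∧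
      ∑ i ∈ sameIndices n, w i ≤ t - ∑ i ∈ oppositeIndices n, w i ∧
      t - ∑ i ∈ oppositeIndices n, w i < ∑ i ∈ sameIndices n, w i + w n} ×ˢ
      {e : ℕ → ℤ | ∀ k < n, e k = (-1) ^ (k + (a : ℕ))}) (measurableSet_singleton _)
    ((measurableSet_waiting n t hC).prod (measurableSet_turns n a))
  have h2 := hd.waiting_turn_indep.measure_inter_preimage_eq_mul _ _
    (measurableSet_waiting n t hC) (measurableSet_turns n a)
  have h3 := measure_sum_waiting (n := n) (k := (n - 1) / 2) (l := n / 2) hlam hWm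
    (fun i => (hd.waiting_law i).map_eq) hd.waiting_indep
    (Finset.disjoint_filter_filter_not (Finset.range n) (Finset.range n) fun k => Odd (k + n))
    (by simp) (by simp) ((card_oppositeIndices n).trans (by omega)) (card_sameIndices n) t hC hCt
  rw [show (n - 1) / 2 + n / 2 + 1 = n by omega] at h3
  have h4 : P (J₀ ⁻¹' {((a : ℕ) : ℤ)}) = ENNReal.ofReal (1 / 4) := by
    rw [← uniformOn_direction a, ← hd.initial_law.map_eq,
      Measure.map_apply_of_aemeasurable hd.initial_law.aemeasurable (measurableSet_singleton _)]
  calc P (alternatingEvent J₀ W E t n a C) = _ := h1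
    _ = P (J₀ ⁻¹' {((a : ℕ) : ℤ)}) * _ := congrArg _ h2
    _ = ENNReal.ofReal (1 / 4) * (_ * ENNReal.ofReal (turnWeight p q n a)) := by
      rw [h4]
      exact congrArg _ (congrArg₂ _ h3 (measure_turns_eq hp hq hd n a))
    _ = _ := by
      rw [ENNReal.ofReal_mul (by norm_num)]
      ring

lemma oppositeTime_eq_iff (hc : 0 < c) (t : ℝ) (n a : ℕ) (x η : ℝ) :
    oppositeTime c t n a η = x ↔ c * (-1) ^ (n + a) * (t - 2 * x) = η := by
  unfold oppositeTime
  rcases neg_one_pow_eq_or ℝ (n + a) with h | h <;> rw [h] <;> field_simp <;>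
    constructor <;> intro h <;> linarith

lemma image_oppositeTime (hc : 0 < c) (t : ℝ) (n a : ℕ) (B : Set ℝ) :
    oppositeTime c t n a '' B = {x | c * (-1) ^ (n + a) * (t - 2 * x) ∈ B} := by
  ext x
  simp only [Set.mem_image, oppositeTime_eq_iff hc, Set.mem_ofPred_eq]
  exact ⟨fun ⟨η, h, h'⟩ => h' ▸ h, fun h => ⟨_, h, rfl⟩⟩

lemma lintegral_oppositeTime (hc : 0 < c) (lam t : ℝ) (n a : ℕ) {B : Set ℝ}
    (hB : MeasurableSet B) :
    ∫⁻ x in {x | c * (-1) ^ (n + a) * (t - 2 * x) ∈ B}, ENNReal.ofReal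
      (lam ^ n * Real.exp (-(lam * t)) * x ^ ((n - 1) / 2) *
        (t - x) ^ (n / 2) / ((((n - 1) / 2).factorial : ℝ) * ((n / 2).factorial : ℝ))) =
      ∫⁻ η in B, ENNReal.ofReal (pieceDensity c lam t n (oppositeTime c t n a η)) := by
  have hderiv : ∀ η ∈ B, HasDerivWithinAt (oppositeTime c t n a)
      (-((-1) ^ (n + a) / c) / 2) B η := by
    intro η _
    have := ((((hasDerivAt_id η).const_mul ((-1) ^ (n + a))).div_const c).const_sub t).div_const 2
    unfold oppositeTime
    convert! this.hasDerivWithinAt using 1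
    ring
  have hinj : Set.InjOn (oppositeTime c t n a) B := fun x _ y _ h =>
    ((oppositeTime_eq_iff hc t n a _ x).1 h).symm.trans ((oppositeTime_eq_iff hc t n a _ y).1 rfl)
  rw [← image_oppositeTime hc, lintegral_image_eq_lintegral_abs_deriv_mul hB hderiv hinj]
  refine lintegral_congr fun η => ?_
  rw [← ENNReal.ofReal_mul (abs_nonneg _)]
  congr 1
  have : |-((-1 : ℝ) ^ (n + a) / c) / 2| = 1 / (2 * c) := by
    rw [abs_div, abs_neg, abs_div, abs_pow, abs_neg, abs_one, one_pow, abs_of_pos hc]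
    norm_num
    field_simp
  rw [this, pieceDensity]
  ring

lemma ae_isRegularPath [IsProbabilityMeasure P] (hlam : 0 < lam)
    (hd : IsDriving P lam p q J₀ W E) (hWm : ∀ i, Measurable (W i)) {t : ℝ} (ht : 0 < t) :
    ∀ᵐ ω ∂P, IsRegularPath J₀ W E t ω := by
  have hW := fun i => (hd.waiting_law i).map_eq
  have h1 : ∀ᵐ ω ∂P, J₀ ω ∈ ({0, 1, 2, 3} : Set ℤ) := by
    refine ae_of_ae_map hd.initial_law.aemeasurable (p := fun j => j ∈ ({0, 1, 2, 3} : Set ℤ)) ?_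
    rw [hd.initial_law.map_eq]
    rw [ae_iff]
    refine (uniformOn_eq_zero_iff (Set.toFinite _)).2 ?_
    ext j
    simp
    tauto
  have h2 : ∀ᵐ ω ∂P, ∀ k, E k ω = 1 ∨ E k ω = -1 ∨ E k ω = 2 := by
    refine ae_all_iff.2 fun k => ae_of_ae_map (hd.turn_law k).aemeasurable
      (p := fun j => j = 1 ∨ j = -1 ∨ j = 2) ?_
    rw [(hd.turn_law k).map_eq, ae_iff]
    simp [turnLaw]
  filter_upwards [ae_waiting_pos hlam hWm hW, ae_arrivalTime_ne hlam hWm hW hd.waiting_indep ht,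
    ae_arrivalTime_tendsto hlam hWm hW hd.waiting_indep, h1, h2] with ω a1 a2 a3 a4 a5
  exact ⟨a1, a2, a3, a4, a5⟩

/-- Almost surely the integral is the limit of measurable finite sums over stretches truncated at
`t`, which are constant once the arrival times have passed `t`. -/
lemma aemeasurable_integral_direction [IsProbabilityMeasure P] (hlam : 0 < lam)
    (hd : IsDriving P lam p q J₀ W E) (hJm : Measurable J₀) (hWm : ∀ i, Measurable (W i))
    (hEm : ∀ i, Measurable (E i)) (G : ℤ → ℝ) {t : ℝ} (ht : 0 < t) :
    AEMeasurable (fun ω => ∫ s in (0 : ℝ)..t, G (dirIndex J₀ W E s ω)) P := by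
  have hS : ∀ n, Measurable (arrivalTime W n) := fun n =>
    Finset.measurable_fun_sum _ fun i _ => hWm i
  refine aemeasurable_of_tendsto_metrizable_ae Filter.atTop (f := fun m ω =>
    ∑ k ∈ Finset.range m, G (J₀ ω + ∑ i ∈ Finset.range k, E i ω) *
      (min (arrivalTime W (k + 1) ω) t - min (arrivalTime W k ω) t)) (fun m => ?_) ?_
  · have hG : ∀ k, Measurable fun ω => G (J₀ ω + ∑ i ∈ Finset.range k, E i ω) := fun k =>
      (measurable_of_countable G).comp (by fun_prop)
    exact (Finset.measurable_fun_sum _ fun k _ => (hG k).mul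
      (((hS (k + 1)).min measurable_const).sub ((hS k).min measurable_const))).aemeasurable
  · filter_upwards [ae_isRegularPath hlam hd hWm ht] with ω hω
    refine tendsto_const_nhds.congr' ?_
    filter_upwards [hω.arrival_tendsto.eventually_ge_atTop t] with m hm
    exact integral_comp_eventCount hω.waiting_pos
      (fun k => G (J₀ ω + ∑ i ∈ Finset.range k, E i ω)) ht.le hm

lemma sideDensity_nonneg (hc : 0 < c) (hlam : 0 < lam) (hp : 0 ≤ p) (hq : 0 ≤ q) {t η : ℝ}
    (hη : |η| < c * t) : 0 ≤ sideDensity c lam p q η t := by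
  rw [← (hasSum_sideDensity (lam := lam) hc hp hq hη).tsum_eq]
  refine tsum_nonneg fun i => Finset.sum_nonneg fun a _ => ?_
  have h := oppositeTime_mem_Ioo hc hη (i + 1) a
  exact mul_nonneg (mul_nonneg (by norm_num) (turnWeight_nonneg hp hq _ _))
    (pieceDensity_nonneg hc hlam h.1.le h.2.le _)

lemma measure_event_eq [IsProbabilityMeasure P] (hc : 0 < c) (hlam : 0 < lam) (hp : 0 ≤ p)
    (hq : 0 ≤ q) (hd : IsDriving P lam p q J₀ W E) (hJm : Measurable J₀)
    (hWm : ∀ i, Measurable (W i)) (hEm : ∀ i, Measurable (E i)) {t : ℝ} (ht : 0 < t) {B : Set ℝ}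
    (hB : MeasurableSet B) (hBt : B ⊆ Set.Ioo (-(c * t)) (c * t)) :
    P {ω | posX c J₀ W E t ω + posY c J₀ W E t ω = c * t ∧
        posX c J₀ W E t ω - posY c J₀ W E t ω ∈ B} =
      ∫⁻ η in B, ENNReal.ofReal (sideDensity c lam p q η t) := by
  have hBt' : ∀ η ∈ B, |η| < c * t := fun η hη => abs_lt.2 (hBt hη)
  set C : ℕ × Fin 2 → Set ℝ := fun i =>
    {x | c * (-1) ^ (i.1 + 1 + (i.2 : ℕ)) * (t - 2 * x) ∈ B} with hC
  have hCm : ∀ i, MeasurableSet (C i) := fun i =>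
    hB.preimage (f := fun x => c * (-1) ^ (i.1 + 1 + (i.2 : ℕ)) * (t - 2 * x)) (by fun_prop)
  have hCt : ∀ i, C i ⊆ Set.Ioo 0 t := by
    intro i
    simp only [hC, ← image_oppositeTime hc]
    rintro _ ⟨η, hη, rfl⟩
    exact oppositeTime_mem_Ioo hc (hBt' η hη) _ _
  have hreg := ae_isRegularPath hlam hd hWm ht
  have hae : {ω | posX c J₀ W E t ω + posY c J₀ W E t ω = c * t ∧
      posX c J₀ W E t ω - posY c J₀ W E t ω ∈ B} =ᵐ[P]
      ⋃ i : ℕ × Fin 2, alternatingEvent J₀ W E t (i.1 + 1) i.2 (C i) := by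
    refine Filter.eventuallyEq_set.2 ?_
    filter_upwards [hreg] with ω hω
    rw [Set.mem_iUnion]
    exact event_iff_exists_alternatingEvent hc ht hBt hω
  rw [measure_congr hae, measure_iUnion₀ _ fun i =>
    (measurableSet_alternatingEvent hJm hWm hEm t _ _ (hCm i)).nullMeasurableSet]
  · have hterm : ∀ i : ℕ × Fin 2, P (alternatingEvent J₀ W E t (i.1 + 1) i.2 (C i)) =
        ∫⁻ η in B, ENNReal.ofReal (1 / 4 * turnWeight p q (i.1 + 1) i.2 *
          pieceDensity c lam t (i.1 + 1) (oppositeTime c t (i.1 + 1) i.2 η)) := by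
      intro i
      rw [measure_alternatingEvent hlam hp hq hd hWm t (by omega) i.2 (hCm i) (hCt i),
        lintegral_oppositeTime hc lam t _ _ hB, ← lintegral_const_mul' _ _ ENNReal.ofReal_ne_top]
      refine lintegral_congr fun η => ?_
      rw [ENNReal.ofReal_mul (mul_nonneg (by norm_num) (turnWeight_nonneg hp hq _ _))]
    have hmeas : ∀ i : ℕ × Fin 2, Measurable fun η => ENNReal.ofReal
        (1 / 4 * turnWeight p q (i.1 + 1) i.2 *
          pieceDensity c lam t (i.1 + 1) (oppositeTime c t (i.1 + 1) i.2 η)) := by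
      intro i
      unfold pieceDensity oppositeTime
      fun_prop
    simp_rw [hterm]
    -- Tonelli moves the sum inside the integral, where it is compared pointwise with the real
    -- series of `hasSum_sideDensity`.
    rw [← lintegral_tsum fun i => (hmeas i).aemeasurable]
    refine setLIntegral_congr_fun hB fun η hη => ?_
    have hnn : ∀ (i : ℕ) (a : Fin 2), 0 ≤ 1 / 4 * turnWeight p q (i + 1) a *
        pieceDensity c lam t (i + 1) (oppositeTime c t (i + 1) a η) := fun i a => by
      have h := oppositeTime_mem_Ioo hc (hBt' η hη) (i + 1) a
      exact mul_nonneg (mul_nonneg (by norm_num) (turnWeight_nonneg hp hq _ _))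
        (pieceDensity_nonneg hc hlam h.1.le h.2.le _)
    have hs := hasSum_sideDensity (lam := lam) hc hp hq (hBt' η hη)
    rw [ENNReal.tsum_prod', ← hs.tsum_eq, ENNReal.ofReal_tsum_of_nonneg
      (fun i => Finset.sum_nonneg fun a _ => hnn i a) hs.summable]
    refine tsum_congr fun i => ?_
    rw [tsum_fintype, ENNReal.ofReal_sum_of_nonneg fun a _ => hnn i a]
  -- The pieces are disjoint only up to a null set: on regular paths the event count and the initial
  -- direction determine the piece.
  · intro i j hij
    refine measure_mono_null ?_ hreg
    rintro ω ⟨h1, h2⟩ hω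
    obtain ⟨h3, h4⟩ := eq_of_mem_alternatingEvent hω h1 h2
    exact hij (Prod.ext (by omega) h4)

lemma IsDriving.congr (hd : IsDriving P lam p q J₀ W E) {J₀' : Ω → ℤ} {W' : ℕ → Ω → ℝ}
    {E' : ℕ → Ω → ℤ} (hJ : J₀ =ᵐ[P] J₀') (hW : ∀ i, W i =ᵐ[P] W' i) (hE : ∀ i, E i =ᵐ[P] E' i) :
    IsDriving P lam p q J₀' W' E' := by
  have hW' : (fun ω n => W n ω) =ᵐ[P] fun ω n => W' n ω := by
    filter_upwards [ae_all_iff.2 hW] with ω h using funext h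
  have hE' : (fun ω n => E n ω) =ᵐ[P] fun ω n => E' n ω := by
    filter_upwards [ae_all_iff.2 hE] with ω h using funext h
  exact ⟨hd.initial_law.congr hJ.symm, fun n => (hd.waiting_law n).congr (hW n).symm,
    fun n => (hd.turn_law n).congr (hE n).symm, hd.waiting_indep.congr hW, hd.turn_indep.congr hE,
    hd.waiting_turn_indep.congr hW' hE', hd.initial_indep.congr hJ (hW'.prodMk hE')⟩

end Driving

end PlanarMotion

end

theorem mainTheorem4 {Ω : Type*} [MeasurableSpace Ω] (P : Measure Ω) [IsProbabilityMeasure P]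
    (c lam p q : ℝ) (hc : 0 < c) (hlam : 0 < lam) (hp : 0 ≤ p) (hq : 0 ≤ q) (hpq : p + q ≤ 1)
    (J₀ : Ω → ℤ) (W : ℕ → Ω → ℝ) (E : ℕ → Ω → ℤ)
    (hdrive : PlanarMotion.IsDriving P lam p q J₀ W E)
    (t : ℝ) (ht : 0 < t) :
    AEMeasurable (PlanarMotion.posX c J₀ W E t) P ∧
    AEMeasurable (PlanarMotion.posY c J₀ W E t) P ∧
    (∀ η : ℝ, |η| < c * t →
      DifferentiableAt ℝ (fun s => PlanarMotion.besselProfile c lam p q η s) t ∧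
      0 ≤ PlanarMotion.sideDensity c lam p q η t) ∧
    ∀ B : Set ℝ, MeasurableSet B → B ⊆ Set.Ioo (-(c * t)) (c * t) →
      P {ω | PlanarMotion.posX c J₀ W E t ω + PlanarMotion.posY c J₀ W E t ω = c * t ∧
            PlanarMotion.posX c J₀ W E t ω - PlanarMotion.posY c J₀ W E t ω ∈ B} =
        ∫⁻ η in B, ENNReal.ofReal (PlanarMotion.sideDensity c lam p q η t) := by
  have hJm := hdrive.initial_law.aemeasurable
  have hWm := fun i => (hdrive.waiting_law i).aemeasurable
  have hEm := fun i => (hdrive.turn_law i).aemeasurable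
  have hJ := hJm.measurable_mk
  have hW := fun i => (hWm i).measurable_mk
  have hE := fun i => (hEm i).measurable_mk
  -- The driving variables are only almost everywhere measurable. Measurable versions keep the laws
  -- and independence, and almost surely give the same path at all times.
  have hd := hdrive.congr hJm.ae_eq_mk (fun i => (hWm i).ae_eq_mk) fun i => (hEm i).ae_eq_mk
  have hdir : ∀ᵐ ω ∂P, ∀ s, PlanarMotion.dirIndex J₀ W E s ω =
      PlanarMotion.dirIndex (hJm.mk _) (fun i => (hWm i).mk _) (fun i => (hEm i).mk _) s ω := by
    filter_upwards [hJm.ae_eq_mk, ae_all_iff.2 fun i => (hWm i).ae_eq_mk,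
      ae_all_iff.2 fun i => (hEm i).ae_eq_mk] with ω h1 h2 h3
    exact PlanarMotion.dirIndex_congr h1 h2 h3
  have hX : PlanarMotion.posX c J₀ W E t =ᵐ[P] PlanarMotion.posX c (hJm.mk _)
      (fun i => (hWm i).mk _) (fun i => (hEm i).mk _) t := by
    filter_upwards [hdir] with ω h
    simp only [PlanarMotion.posX, h]
  have hY : PlanarMotion.posY c J₀ W E t =ᵐ[P] PlanarMotion.posY c (hJm.mk _)
      (fun i => (hWm i).mk _) (fun i => (hEm i).mk _) t := by
    filter_upwards [hdir] with ω h
    simp only [PlanarMotion.posY, h]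
  refine ⟨?_, ?_, fun η hη => ⟨?_, ?_⟩, fun B hB hBt => ?_⟩
  · exact (PlanarMotion.aemeasurable_integral_direction hlam hd hJ hW hE
      (fun j => c * Real.cos (Real.pi / 2 * (j : ℝ))) ht).congr hX.symm
  · exact (PlanarMotion.aemeasurable_integral_direction hlam hd hJ hW hE
      (fun j => c * Real.sin (Real.pi / 2 * (j : ℝ))) ht).congr hY.symm
  · exact (PlanarMotion.hasDerivAt_besselProfile hc (mul_nonneg hp hq) hη).differentiableAt
  · exact PlanarMotion.sideDensity_nonneg hc hlam hp hq hη
  · rw [← PlanarMotion.measure_event_eq hc hlam hp hq hd hJ hW hE ht hB hBt]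
    refine measure_congr (Filter.eventuallyEq_set.2 ?_)
    filter_upwards [hX, hY] with ω h1 h2
    simp only [h1, h2]
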